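/- Fix $R\in\mathbb N$. An environment is $\omega=(\omega_{s,x})_{(s,x)\in\mathbb Z\times\mathbb Z}$, where each $\omega_{s,x}=(\omega_{s,x}(z))_{|z|\le R}$ is a probability vector on $\{z\in\mathbb Z:|z|\le R\}$. Let $\mathbb P$ be a probability measure on the space of environments under which the $\omega_{s,x}$ are i.i.d., and let $p(u)=\mathbb E[\omega_{0,0}(u)]$. Assume that $\mathbb P\{\exists z:0<\omega_{0,0}(z)<1\}>0$ and that there are no $x\in\mathbb Z$ and subgroup $G\subsetneq\mathbb Z$ with $\sum_{z\in G}p(x+z)=1$. In the environment $\omega$, a walk at site $x$ at time $s$ jumps to $y$ with probability $\omega_{s,x}(y-x)$; let $\pi^\omega_{s,t}(x,y)$ be the corresponding transition probabilities from time $s$ to time $t$. Let $(T_{s,x}\omega)_{t,y}=\omega_{s+t,x+y}$ and $$f(\omega)=\lim_{N\to\infty}f_N(\omega),\qquad f_N(\omega)=\sum_{z\in\mathbb Z}\pi^\omega_{-N,0}(z,0).$$ For $\rho\ge 0$ let $\mu^{\rho,\omega}$ be the law of a configuration $\eta=(\eta(x))_{x\in\mathbb Z}$ of independent Poisson variables with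 means $\rho f(T_{0,x}\omega)$, and let $\mu^\rho=\int\mu^{\rho,\omega}\,\mathbb P(d\omega)$ be the stationary measure. Let $\eta_s(x)$ be the number of particles at $x$ at time $s\in\mathbb Z_+$ when, in an environment with law $\mathbb P$, particles start from a configuration $\eta_0$ with law $\mu^\rho$ that is independent of the environment and of the walks, and, given the environment, move independently of each other according to the transition probabilities above. Suppose that $p(x)+p(x+1)=1$ for some $x\in\mathbb Z$. Then the limit defining $f$ exists $\mathbb P$-almost surely, $\mathbb E[f]=1$, $\mathbb E[f^2]<\infty$, and $$\operatorname{Cov}[f(\omega),f(T_{0,m}\omega)]=0\qquad\text{for all } m\in\mathbb Z,\ m\ne0.$$ Moreover, fixed-time occupation variables in the stationary process are uncorrelated: for all $\rho\ge0$ and all $x\ne y$ in $\mathbb Z$, the variables $\eta(x),\eta(y)$ are square integrable with covariance $0$ under $\mu^\rho$, and for every $s\in\mathbb Z_+$ the variables $\eta_s(x),\eta_s(y)$ are square integrable with covariance $0$. -/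

import Mathlib

open MeasureTheory ProbabilityTheory Filter Topology
open scoped NNReal ENNReal

noncomputable section

namespace DynEnv

/-- Jump probability vectors on `ℤ` with range at most `R`. -/
abbrev JumpLaw (R : ℕ) : Type :=
  {v : ℤ → ℝ // (∀ z, 0 ≤ v z) ∧ (∀ z, (R : ℤ) < |z| → v z = 0) ∧
    ∑ z ∈ Finset.Icc (-(R : ℤ)) R, v z = 1}

/-- Space-time environments: `ω (s, x)` is the jump law at time `s` and site `x`.  The
σ-algebra is the product one. -/
abbrev Env (R : ℕ) : Type := ℤ × ℤ → JumpLaw R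

/-- The shift `T_{s,x}`. -/
def shift {R : ℕ} (s x : ℤ) (ω : Env R) : Env R := fun i => ω (s + i.1, x + i.2)

/-- `trans ω n s x y` is the quenched `n`-step transition probability `π_{s,s+n}(x,y)`. -/
def trans {R : ℕ} (ω : Env R) : ℕ → ℤ → ℤ → ℤ → ℝ
  | 0, _, x, y => if x = y then 1 else 0
  | n + 1, s, x, y =>
      ∑ z ∈ Finset.Icc (-(R : ℤ)) R, (ω (s, x)).1 z * trans ω n (s + 1) (x + z) y

/-- `f_N(ω) = ∑_z π_{-N,0}(z,0)`; the sum has finitely many nonzero terms. -/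
def preDensity {R : ℕ} (N : ℕ) (ω : Env R) : ℝ := ∑' z : ℤ, trans ω N (-(N : ℤ)) z 0

/-- The density `f = lim_N f_N`, defined everywhere as an upper limit. -/
def density {R : ℕ} (ω : Env R) : ℝ := limsup (fun N : ℕ => preDensity N ω) atTop

/-- The mean transition kernel `p(u) = E[ω_{0,0}(u)]`. -/
def meanKernel {R : ℕ} (P : Measure (Env R)) (u : ℤ) : ℝ := ∫ ω, (ω (0, 0)).1 u ∂P

/-- Particle configurations on `ℤ`. -/
abbrev Config : Type := ℤ → ℕ

/-- The product measure `μ^{ρ,ω}`: independent Poisson occupation variables with means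
`ρ f(T_{0,x} ω)`. -/
def quenchedPoisson {R : ℕ} (ρ : ℝ≥0) (ω : Env R) : Measure Config :=
  Measure.infinitePi fun x : ℤ => poissonMeasure (ρ * (density (shift 0 x ω)).toNNReal)

/-- The averaged measure `μ^ρ = ∫ μ^{ρ,ω} P(dω)`. -/
def stationaryMeasure {R : ℕ} (P : Measure (Env R)) (ρ : ℝ≥0) : Measure Config :=
  P.bind (quenchedPoisson ρ)

/-- Law of the next position of a walk which is at `x` and jumps according to `v`. -/
def stepLaw {R : ℕ} (v : JumpLaw R) (x : ℤ) : Measure ℤ :=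
  ∑ z ∈ Finset.Icc (-(R : ℤ)) R, ENNReal.ofReal (v.1 z) • Measure.dirac (x + z)

/-- The time-`n` transition of the quenched walk, as a kernel from histories. -/
def walkKernel {R : ℕ} (ω : Env R) (n : ℕ) : Kernel (Finset.Iic n → ℤ) ℤ :=
  Kernel.ofFunOfCountable fun h =>
    stepLaw (ω ((n : ℤ), h ⟨n, Finset.mem_Iic.2 le_rfl⟩)) (h ⟨n, Finset.mem_Iic.2 le_rfl⟩)

instance {R : ℕ} (v : JumpLaw R) (x : ℤ) : IsProbabilityMeasure (stepLaw v x) := by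
  constructor
  simp only [stepLaw, Measure.coe_finsetSum, Finset.sum_apply, Measure.smul_apply, measure_univ,
    smul_eq_mul, mul_one]
  rw [← ENNReal.ofReal_sum_of_nonneg fun z _ => v.2.1 z, v.2.2.2, ENNReal.ofReal_one]

instance {R : ℕ} (ω : Env R) (n : ℕ) : IsMarkovKernel (walkKernel ω n) :=
  ⟨fun h => by
    change IsProbabilityMeasure (stepLaw _ _)
    infer_instance⟩

/-- The quenched path law of a walk started from `u` at time `0`. -/
def walkLaw {R : ℕ} (ω : Env R) (u : ℤ) : Measure (ℕ → ℤ) :=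
  Kernel.traj (X := fun _ => ℤ) (walkKernel ω) 0 fun _ => u

instance {R : ℕ} (ω : Env R) (u : ℤ) : IsProbabilityMeasure (walkLaw ω u) := by
  unfold walkLaw
  infer_instance

/-- Paths of all the walks: `X (u, j) s` is the position at time `s` of the walk number `j` among
those started from site `u`. -/
abbrev Paths : Type := ℤ × ℕ → ℕ → ℤ

/-- The joint quenched law of the walks, which are independent given the environment. -/
def quenchedWalks {R : ℕ} (ω : Env R) : Measure Paths :=
  Measure.infinitePi fun i : ℤ × ℕ => walkLaw ω i.1

/-- The averaged law of the initial configuration and the walks: in the environment `ω` the initial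
configuration has law `μ` and is independent of the walks; then `ω` is averaged out. -/
def particleLaw {R : ℕ} (P : Measure (Env R)) (μ : Measure Config) : Measure (Config × Paths) :=
  P.bind fun ω => μ.prod (quenchedWalks ω)

/-- The occupation variable `η_s(x)`: the number of particles which are at `x` at time `s`, where
`η u` particles start from each site `u`. -/
def occupation (s : ℕ) (x : ℤ) (c : Config × Paths) : ℕ :=
  ∑' u : ℤ, ∑ j ∈ Finset.range (c.1 u), if c.2 (u, j) s = x then 1 else 0

/-! Measurability in the environment of the measures that are averaged above. -/

lemma measurable_jump {R : ℕ} (i : ℤ × ℤ) (z : ℤ) : Measurable fun ω : Env R => (ω i).1 z :=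
  (measurable_pi_apply z).comp (measurable_subtype_coe.comp (measurable_pi_apply i))

lemma measurable_shift {R : ℕ} (s x : ℤ) : Measurable (shift s x : Env R → Env R) :=
  measurable_pi_lambda _ fun _ => measurable_pi_apply _

lemma measurable_trans {R : ℕ} (n : ℕ) (s x y : ℤ) :
    Measurable fun ω : Env R => trans ω n s x y := by
  induction n generalizing s x with
  | zero => exact measurable_const
  | succ n ih =>
    exact Finset.measurable_fun_sum _ fun z _ => (measurable_jump _ _).mul (ih _ _)

lemma trans_eq_zero {R : ℕ} (ω : Env R) (n : ℕ) (s x y : ℤ) (h : (n : ℤ) * R < |y - x|) :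
    trans ω n s x y = 0 := by
  induction n generalizing s x with
  | zero =>
    have : x ≠ y := by rintro rfl; simp at h
    simp [trans, this]
  | succ n ih =>
    refine Finset.sum_eq_zero fun z hz => ?_
    rw [ih, mul_zero]
    rw [Finset.mem_Icc, ← abs_le] at hz
    have h1 : |y - x| ≤ |y - (x + z)| + |z| := by
      have := abs_add_le (y - (x + z)) z
      rwa [show y - (x + z) + z = y - x by ring] at this
    push_cast at h
    linarith

lemma measurable_preDensity {R : ℕ} (N : ℕ) : Measurable (preDensity N : Env R → ℝ) := by
  have : (preDensity N : Env R → ℝ) = fun ω =>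
      ∑ z ∈ Finset.Icc (-((N : ℤ) * R)) (N * R), trans ω N (-(N : ℤ)) z 0 := by
    funext ω
    refine tsum_eq_sum fun z hz => trans_eq_zero _ _ _ _ _ ?_
    rw [Finset.mem_Icc, ← abs_le, not_le] at hz
    simpa using hz
  rw [this]
  exact Finset.measurable_fun_sum _ fun z _ => measurable_trans _ _ _ _

lemma measurable_density {R : ℕ} : Measurable (density : Env R → ℝ) :=
  Measurable.limsup measurable_preDensity

lemma measurable_infinitePi {Ω ι : Type*} {X : ι → Type*} [MeasurableSpace Ω]
    [∀ i, MeasurableSpace (X i)] (μ : Ω → ∀ i, Measure (X i))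
    [∀ ω i, IsProbabilityMeasure (μ ω i)] (h : ∀ i, Measurable fun ω => μ ω i) :
    Measurable fun ω => Measure.infinitePi (μ ω) := by
  refine Measurable.measure_of_isPiSystem_of_isProbabilityMeasure
    generateFrom_squareCylinders.symm
    (isPiSystem_squareCylinders (fun _ => MeasurableSpace.isPiSystem_measurableSet) (by simp)) ?_
  rintro _ ⟨s, t, ht, rfl⟩
  have ht' : ∀ i, MeasurableSet (t i) := fun i => ht i (Set.mem_univ i)
  have : (fun ω => Measure.infinitePi (μ ω) ((s : Set ι).pi t)) =
      fun ω => ∏ i ∈ s, μ ω i (t i) := by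
    funext ω
    exact Measure.infinitePi_pi _ fun i _ => ht' i
  rw [this]
  exact Finset.measurable_fun_prod _ fun i _ => (Measure.measurable_coe (ht' i)).comp (h i)

lemma measurable_quenchedPoisson {R : ℕ} (ρ : ℝ≥0) :
    Measurable (quenchedPoisson ρ : Env R → Measure Config) := by
  refine measurable_infinitePi _ fun x => ?_
  have h1 : Measurable fun ω : Env R => ρ * (density (shift 0 x ω)).toNNReal :=
    ((measurable_density.comp (measurable_shift 0 x)).real_toNNReal).const_mul _
  have h2 : Measurable poissonMeasure := by
    refine Measure.measurable_of_measurable_coe _ fun s hs => ?_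
    simp only [poissonMeasure, Measure.sum_apply _ hs, Measure.smul_apply, smul_eq_mul]
    fun_prop
  exact h2.comp h1

lemma measurable_walkLaw {R : ℕ} (u : ℤ) : Measurable fun ω : Env R => walkLaw ω u := by
  have hstep : ∀ (n : ℕ) (h : Finset.Iic n → ℤ) (S : Set ℤ),
      Measurable fun ω : Env R => walkKernel ω n h S := by
    intro n h S
    change Measurable fun ω : Env R => stepLaw _ _ S
    simp only [stepLaw, Measure.coe_finsetSum, Finset.sum_apply, Measure.smul_apply, smul_eq_mul]
    exact Finset.measurable_fun_sum _ fun z _ =>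
      (measurable_jump _ _).ennreal_ofReal.mul_const _
  have hpart : ∀ n : ℕ, Measurable fun ω : Env R =>
      Kernel.partialTraj (X := fun _ => ℤ) (walkKernel ω) 0 n fun _ => u := by
    intro n
    induction n with
    | zero =>
      simp only [Kernel.partialTraj_self]
      exact measurable_const
    | succ n ih =>
      refine Measure.measurable_of_measurable_coe _ fun S hS => ?_
      have : ∀ ω : Env R, Kernel.partialTraj (X := fun _ => ℤ) (walkKernel ω) 0 (n + 1)
          (fun _ => u) S = ∑' h : Finset.Iic n → ℤ,
          walkKernel ω n h ((fun z => IicProdIoc (X := fun _ => ℤ) n (n + 1)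
            (h, MeasurableEquiv.piSingleton (X := fun _ => ℤ) n z)) ⁻¹' S) *
          Kernel.partialTraj (X := fun _ => ℤ) (walkKernel ω) 0 n (fun _ => u) {h} := by
        intro ω
        rw [Kernel.partialTraj_succ_eq_comp (Nat.zero_le n), Kernel.comp_apply' _ _ _ hS,
          lintegral_countable']
        refine tsum_congr fun h => ?_
        congr 1
        rw [Kernel.partialTraj_succ_self, Kernel.map_apply' _ (by fun_prop) _ hS,
          Kernel.prod_apply, Kernel.id_apply, Kernel.map_apply _ (by fun_prop),
          Measure.dirac_prod, Measure.map_map (by fun_prop) (by fun_prop)]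
        exact Measure.map_apply (by fun_prop) (measurable_IicProdIoc (X := fun _ => ℤ) hS)
      simp only [this]
      exact Measurable.tsum fun h =>
        (hstep _ _ _).mul ((Measure.measurable_coe (measurableSet_singleton h)).comp ih)
  refine Measurable.measure_of_isPiSystem_of_isProbabilityMeasure
    generateFrom_measurableCylinders.symm isPiSystem_measurableCylinders ?_
  intro A hA
  obtain ⟨n, S, hS, rfl⟩ : ∃ (n : ℕ) (S : Set (Finset.Iic n → ℤ)), MeasurableSet S ∧
      A = Preorder.frestrictLe (π := fun _ => ℤ) n ⁻¹' S := by
    obtain ⟨s, T, hT, rfl⟩ := (mem_measurableCylinders _).1 hA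
    refine ⟨s.sup id, Finset.restrict₂ (π := fun _ => ℤ) (Finset.subset_Iic_sup_id s) ⁻¹' T,
      Finset.measurable_restrict₂ _ hT, rfl⟩
  have : (fun ω : Env R => walkLaw ω u (Preorder.frestrictLe (π := fun _ => ℤ) n ⁻¹' S)) =
      fun ω => Kernel.partialTraj (X := fun _ => ℤ) (walkKernel ω) 0 n (fun _ => u) S := by
    funext ω
    rw [← Kernel.traj_map_frestrictLe_apply, Measure.map_apply (by fun_prop) hS]
    rfl
  rw [this]
  exact (Measure.measurable_coe hS).comp (hpart n)

lemma measurable_quenchedWalks {R : ℕ} : Measurable (quenchedWalks : Env R → Measure Paths) :=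
  measurable_infinitePi _ fun i => measurable_walkLaw i.1

instance {R : ℕ} (ω : Env R) : IsProbabilityMeasure (quenchedWalks ω) := by
  unfold quenchedWalks
  infer_instance

lemma measurable_prod_quenchedWalks {R : ℕ} (μ : Measure Config) [IsProbabilityMeasure μ] :
    Measurable fun ω : Env R => μ.prod (quenchedWalks ω) := by
  let κ : Kernel (Env R) Paths := ⟨quenchedWalks, measurable_quenchedWalks⟩
  have : IsMarkovKernel κ := ⟨fun ω => inferInstanceAs (IsProbabilityMeasure (quenchedWalks ω))⟩
  have h : (fun ω : Env R => μ.prod (quenchedWalks ω)) = (Kernel.const (Env R) μ ×ₖ κ) := by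
    funext ω
    rw [Kernel.prod_apply, Kernel.const_apply]
    rfl
  rw [h]
  exact Kernel.measurable _

instance {R : ℕ} (P : Measure (Env R)) [IsProbabilityMeasure P] (ρ : ℝ≥0) :
    IsProbabilityMeasure (stationaryMeasure P ρ) := by
  refine isProbabilityMeasure_bind (measurable_quenchedPoisson ρ).aemeasurable ?_
  exact Eventually.of_forall fun ω => by
    unfold quenchedPoisson
    infer_instance

instance {R : ℕ} (P : Measure (Env R)) [IsProbabilityMeasure P] (μ : Measure Config)
    [IsProbabilityMeasure μ] : IsProbabilityMeasure (particleLaw P μ) :=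
  isProbabilityMeasure_bind (measurable_prod_quenchedWalks μ).aemeasurable
    (Eventually.of_forall fun _ => inferInstance)

end DynEnv

end

/-!
Let `a`, `a + 1` be the two sites which carry the mean kernel. Almost surely every jump law is
carried by them too. The second moments of masses which are transported by the walks, as functions
of the distance `k` of two sites, then follow a nearest-neighbour recursion `diffStep`, because two
walks in the same environment are independent as long as they are at different sites. Its rate is
`α = p(a) p(a + 1)` at `k ≠ 0` and `β = E[ω(a) ω(a + 1)] ≤ α` at `k = 0`; nondegeneracy says that
`β > 0`. Since the walks jump to two adjacent sites, the recursion only changes `k` by at most one,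
and its invariant vector `invariantCov`, which is `α / rate`, is constant away from `k = 0`. This is
what makes the occupation variables uncorrelated (`integral_sum_sum_trans`).

The masses `f_N` form a martingale in `N` (`martingale_preDensity_shift`). Their second moments
start from the vector `1`, which is below the invariant vector, hence stay below it; so the
martingale is bounded in `L²` and converges almost surely and in `L²`. Multiplied by the rate, the
distance to the invariant vector solves a heat equation on the half-line with a point mass as
initial value, which tends to zero (`tendsto_heat_zero`). Therefore `E[f f∘T_{0,m}]` is exactly the
invariant vector, and equals `1` for `m ≠ 0` (`integral_density_mul`).

Under the stationary measure the pair moments of distinct particles are `ρ²` times the invariant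
vector. The walks transport them by the same recursion, which fixes this vector
(`lintegral_occupation_mul`); pairs formed by one particle with itself do not contribute at two
different sites.
-/

noncomputable section

namespace DynEnv

/-! ### Quenched transition probabilities -/

lemma trans_nonneg {R : ℕ} (ω : Env R) (n : ℕ) (s x y : ℤ) : 0 ≤ trans ω n s x y := by
  induction n generalizing s x with
  | zero => simp only [trans]; split_ifs <;> norm_num
  | succ n ih => exact Finset.sum_nonneg fun z _ => mul_nonneg ((ω (s, x)).2.1 z) (ih _ _)

lemma trans_le_one {R : ℕ} (ω : Env R) (n : ℕ) (s x y : ℤ) : trans ω n s x y ≤ 1 := by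
  induction n generalizing s x with
  | zero => simp only [trans]; split_ifs <;> norm_num
  | succ n ih =>
    rw [← (ω (s, x)).2.2.2]
    exact Finset.sum_le_sum fun z _ => mul_le_of_le_one_right ((ω (s, x)).2.1 z) (ih _ _)

/-- The Kolmogorov equation for the last step; `trans` itself is defined by the first step. -/
lemma trans_succ_last {R : ℕ} (ω : Env R) (n : ℕ) (s x y : ℤ) :
    trans ω (n + 1) s x y = ∑ z ∈ Finset.Icc (-(R : ℤ)) R,
      (ω (s + n, y - z)).1 z * trans ω n s x (y - z) := by
  induction n generalizing s x with
  | zero =>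
    simp only [trans]
    refine Finset.sum_congr rfl fun z _ => ?_
    by_cases h : x + z = y
    · subst h; simp
    · have : ¬ x = y - z := fun h' => h (by omega)
      simp [h, this]
  | succ n ih =>
    rw [trans]
    simp only [ih, Finset.mul_sum]
    rw [Finset.sum_comm]
    refine Finset.sum_congr rfl fun z _ => ?_
    rw [trans, Finset.mul_sum]
    refine Finset.sum_congr rfl fun z' _ => ?_
    rw [show s + 1 + (n : ℤ) = s + ((n + 1 : ℕ) : ℤ) by push_cast; ring]
    ring

lemma trans_shift {R : ℕ} (ω : Env R) (n : ℕ) (s x t u v : ℤ) :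
    trans (shift s x ω) n t u v = trans ω n (s + t) (x + u) (x + v) := by
  induction n generalizing t u with
  | zero => simp [trans]
  | succ n ih =>
    simp only [trans]
    refine Finset.sum_congr rfl fun z _ => ?_
    rw [ih, ← add_assoc, ← add_assoc]
    rfl

/-- The sites from which `x` can be reached in `n` steps. -/
def window (R n : ℕ) (x : ℤ) : Finset ℤ := Finset.Icc (x - n * R) (x + n * R)

lemma mem_window {R n : ℕ} {x u : ℤ} : u ∈ window R n x ↔ |x - u| ≤ n * R := by
  rw [window, Finset.mem_Icc, abs_le]
  constructor <;> rintro ⟨h1, h2⟩ <;> constructor <;> linarith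

lemma trans_eq_zero_of_notMem {R n : ℕ} (ω : Env R) (s : ℤ) {x u : ℤ} (h : u ∉ window R n x) :
    trans ω n s u x = 0 :=
  trans_eq_zero _ _ _ _ _ (by rwa [mem_window, not_le] at h)

lemma window_sub_subset {R n : ℕ} {x z : ℤ} (hz : z ∈ Finset.Icc (-(R : ℤ)) R) :
    window R n (x - z) ⊆ window R (n + 1) x := by
  intro u hu
  simp only [window, Finset.mem_Icc] at *
  push_cast
  constructor <;> linarith

lemma sum_eq_sum_of_eq_zero {ι : Type*} {A B : Finset ι} {f : ι → ℝ} (hA : ∀ i ∉ A, f i = 0)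
    (hB : ∀ i ∉ B, f i = 0) : ∑ i ∈ A, f i = ∑ i ∈ B, f i := by
  classical
  rw [Finset.sum_subset (Finset.subset_union_left (s₂ := B)) fun i _ hi => hA i hi,
    ← Finset.sum_subset (Finset.subset_union_right (s₁ := A)) fun i _ hi => hB i hi]

lemma jump_eq_zero_of_notMem {R : ℕ} (v : JumpLaw R) {z : ℤ} (h : z ∉ Finset.Icc (-(R : ℤ)) R) :
    v.1 z = 0 :=
  v.2.2.1 z (by rwa [Finset.mem_Icc, ← abs_le, not_le] at h)

lemma jump_le_one {R : ℕ} (v : JumpLaw R) (z : ℤ) : v.1 z ≤ 1 := by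
  by_cases h : z ∈ Finset.Icc (-(R : ℤ)) R
  · exact (Finset.single_le_sum (f := v.1) (fun i _ => v.2.1 i) h).trans_eq v.2.2.2
  · rw [jump_eq_zero_of_notMem v h]
    exact zero_le_one

lemma preDensity_shift {R : ℕ} (N : ℕ) (ω : Env R) (x : ℤ) :
    preDensity N (shift 0 x ω) = ∑ u ∈ window R N x, trans ω N (-(N : ℤ)) u x := by
  simp only [preDensity, trans_shift, zero_add, add_zero]
  refine ((Equiv.addLeft x).tsum_eq (fun u => trans ω N (-(N : ℤ)) u x)).trans ?_
  exact tsum_eq_sum fun u hu => trans_eq_zero_of_notMem _ _ hu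

/-- Decomposition of the mass at `x` according to the position after the first step. -/
lemma sum_trans_succ_first {R : ℕ} (ω : Env R) (N : ℕ) (s x : ℤ) :
    ∑ u ∈ window R (N + 1) x, trans ω (N + 1) s u x = ∑ y ∈ window R N x,
      (∑ z ∈ Finset.Icc (-(R : ℤ)) R, (ω (s, y - z)).1 z) * trans ω N (s + 1) y x := by
  simp only [trans, Finset.sum_mul]
  rw [Finset.sum_comm, Finset.sum_comm (s := window R N x)]
  refine Finset.sum_congr rfl fun z hz => ?_
  have h : ∑ y ∈ window R N x, (ω (s, y - z)).1 z * trans ω N (s + 1) y x =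
      ∑ u ∈ (window R N x).map (addRightEmbedding (-z)),
        (ω (s, u)).1 z * trans ω N (s + 1) (u + z) x := by
    rw [Finset.sum_map]
    refine Finset.sum_congr rfl fun y _ => ?_
    simp [sub_eq_add_neg]
  rw [h]
  symm
  refine Finset.sum_subset ?_ ?_
  · intro u hu
    simp only [Finset.mem_map, addRightEmbedding_apply, window, Finset.mem_Icc] at hu hz ⊢
    obtain ⟨y, hy, rfl⟩ := hu
    push_cast
    constructor <;> linarith [hy.1, hy.2, hz.1, hz.2]
  · intro u _ hu
    rw [trans_eq_zero_of_notMem, mul_zero]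
    intro hmem
    exact hu (Finset.mem_map.2 ⟨u + z, hmem, by simp⟩)

/-! ### The difference chain -/

/-- The rate of the difference chain at `k`: `β` at the origin and `α` elsewhere. -/
def rate (α β : ℝ) (k : ℤ) : ℝ := if k = 0 then β else α

/-- One step of the second moments of two masses at distance `k` in a common environment. -/
def diffStep (α β : ℝ) (b : ℤ → ℝ) (k : ℤ) : ℝ :=
  (1 - 2 * rate α β k) * b k + rate α β (k - 1) * b (k - 1) + rate α β (k + 1) * b (k + 1)

/-- The invariant vector of the difference chain. -/
def invariantCov (α β : ℝ) (k : ℤ) : ℝ := α / rate α β k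

lemma invariantCov_of_ne {α β : ℝ} (hα : 0 < α) {k : ℤ} (hk : k ≠ 0) :
    invariantCov α β k = 1 := by
  rw [invariantCov, rate, if_neg hk, div_self hα.ne']

lemma rate_pos {α β : ℝ} (hα : 0 < α) (hβ : 0 < β) (k : ℤ) : 0 < rate α β k := by
  unfold rate; split_ifs <;> assumption

lemma iterate_diffStep_invariantCov {α β : ℝ} (hα : 0 < α) (hβ : 0 < β) (N : ℕ) :
    (diffStep α β)^[N] (invariantCov α β) = invariantCov α β := by
  refine Function.iterate_fixed ?_ N
  funext k
  have h : ∀ j, rate α β j * invariantCov α β j = α := fun j =>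
    mul_div_cancel₀ _ (rate_pos hα hβ j).ne'
  rw [diffStep, sub_mul, mul_assoc, h, h, h]
  ring

/-- A solution of the heat equation on the half-line, with rate `β` at the boundary, which starts
from a point mass at the boundary tends to zero: it stays decreasing in space, so that the value at
the boundary decreases in time, all values have the same limit, and the sums over `0, …, K`,
suitably weighted, are bounded uniformly in time. -/
lemma tendsto_heat_zero {α β : ℝ} (hβ : 0 < β) (hβα : β ≤ α) (hα : α ≤ 1 / 4) (v : ℕ → ℕ → ℝ)
    (h00 : 0 ≤ v 0 0) (h0 : ∀ k, v 0 (k + 1) = 0)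
    (hz : ∀ n, v (n + 1) 0 = v n 0 + 2 * β * (v n 1 - v n 0))
    (hs : ∀ n k, v (n + 1) (k + 1) =
      v n (k + 1) + α * (v n k - 2 * v n (k + 1) + v n (k + 2))) (k : ℕ) :
    (∀ n, 0 ≤ v n k) ∧ Tendsto (fun n => v n k) atTop (𝓝 0) := by
  have hαp : 0 < α := hβ.trans_le hβα
  -- the differences of neighbours solve a similar equation, whose coefficients are nonnegative
  have hdec : ∀ n k, v n (k + 1) ≤ v n k := by
    intro n
    induction n with
    | zero =>
      intro k
      cases k with
      | zero => rw [h0]; exact h00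
      | succ k => rw [h0, h0]
    | succ n ih =>
      intro k
      cases k with
      | zero =>
        rw [hz, hs]
        nlinarith [ih 0, ih 1, mul_nonneg hαp.le (sub_nonneg.2 (ih 1)),
          mul_nonneg (show 0 ≤ 1 - 2 * β - α by linarith) (sub_nonneg.2 (ih 0))]
      | succ k =>
        rw [hs, hs]
        nlinarith [mul_nonneg hαp.le (sub_nonneg.2 (ih k)),
          mul_nonneg hαp.le (sub_nonneg.2 (ih (k + 2))),
          mul_nonneg (show 0 ≤ 1 - 2 * α by linarith) (sub_nonneg.2 (ih (k + 1)))]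
  have hnn : ∀ n k, 0 ≤ v n k := by
    intro n
    induction n with
    | zero =>
      intro k
      cases k with
      | zero => exact h00
      | succ k => rw [h0]
    | succ n ih =>
      intro k
      cases k with
      | zero =>
        rw [hz]
        nlinarith [mul_nonneg hβ.le (ih 1), mul_nonneg (show 0 ≤ 1 - 2 * β by linarith) (ih 0)]
      | succ k =>
        rw [hs]
        nlinarith [mul_nonneg hαp.le (ih k), mul_nonneg hαp.le (ih (k + 2)),
          mul_nonneg (show 0 ≤ 1 - 2 * α by linarith) (ih (k + 1))]
  have hanti : Antitone fun n => v n 0 := antitone_nat_of_succ_le fun n => by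
    rw [hz]
    nlinarith [mul_nonneg hβ.le (sub_nonneg.2 (hdec n 0))]
  obtain ⟨l, hl⟩ : ∃ l, Tendsto (fun n => v n 0) atTop (𝓝 l) :=
    ⟨_, tendsto_atTop_ciInf hanti ⟨0, by rintro _ ⟨n, rfl⟩; exact hnn n 0⟩⟩
  -- the equation at `k` expresses the value at `k + 1` by values at sites up to `k`
  have hall : ∀ k, Tendsto (fun n => v n k) atTop (𝓝 l) ∧
      Tendsto (fun n => v n (k + 1)) atTop (𝓝 l) := by
    intro k
    induction k with
    | zero =>
      refine ⟨hl, ?_⟩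
      have h1 : (fun n => v n (0 + 1)) = fun n => v n 0 + (v (n + 1) 0 - v n 0) / (2 * β) := by
        funext n
        rw [hz]
        field_simp
        ring
      rw [h1]
      have := hl.add ((((tendsto_add_atTop_iff_nat 1).2 hl).sub hl).div_const (2 * β))
      simpa using this
    | succ k ih =>
      refine ⟨ih.2, ?_⟩
      have h1 : (fun n => v n (k + 1 + 1)) = fun n =>
          (v (n + 1) (k + 1) - v n (k + 1)) / α - v n k + 2 * v n (k + 1) := by
        funext n
        rw [hs]
        field_simp
        ring
      rw [h1]
      have := (((((tendsto_add_atTop_iff_nat 1).2 ih.2).sub ih.2).div_const α).sub ih.1).add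
        (ih.2.const_mul 2)
      convert this using 2
      ring
  have hsum : ∀ n K, v n 0 / (2 * β) + (∑ j ∈ Finset.range K, v n (j + 1)) / α ≤
      v 0 0 / (2 * β) := by
    intro n K
    induction n with
    | zero => simp [h0]
    | succ n ih =>
      refine le_trans ?_ ih
      -- the weighted sum changes only by the flux at its right end, which is not positive
      have hflux : ∀ K, v (n + 1) 0 / (2 * β) + (∑ j ∈ Finset.range K, v (n + 1) (j + 1)) / α =
          v n 0 / (2 * β) + (∑ j ∈ Finset.range K, v n (j + 1)) / α + (v n (K + 1) - v n K) := by
        intro K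
        induction K with
        | zero => simp only [Finset.range_zero, Finset.sum_empty]; rw [hz]; field_simp; ring
        | succ K ih =>
          rw [Finset.sum_range_succ, Finset.sum_range_succ, add_div, ← add_assoc, ih, hs]
          field_simp
          ring
      rw [hflux]
      linarith [hdec n K]
  have hl0 : 0 ≤ l := ge_of_tendsto' hl fun n => hnn n 0
  have hbound : ∀ K : ℕ, K * l / α ≤ v 0 0 / (2 * β) := by
    intro K
    have h1 : Tendsto (fun n => (∑ j ∈ Finset.range K, v n (j + 1)) / α) atTop
        (𝓝 ((∑ j ∈ Finset.range K, l) / α)) :=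
      (tendsto_finsetSum _ fun j _ => (hall j).2).div_const α
    rw [Finset.sum_const, Finset.card_range, nsmul_eq_mul] at h1
    refine le_of_tendsto' h1 fun n => ?_
    have := hsum n K
    have h2 : 0 ≤ v n 0 / (2 * β) := div_nonneg (hnn n 0) (by linarith)
    linarith
  have hl' : l = 0 := by
    by_contra hne
    have hlp : 0 < l / α := div_pos (lt_of_le_of_ne hl0 (Ne.symm hne)) hαp
    obtain ⟨K, hK⟩ := exists_nat_gt (v 0 0 / (2 * β) / (l / α))
    rw [div_lt_iff₀ hlp] at hK
    have := hbound K
    rw [mul_div_assoc] at this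
    linarith
  exact ⟨fun n => hnn n k, hl' ▸ (hall k).1⟩

lemma iterate_diffStep_one_neg (α β : ℝ) (N : ℕ) (k : ℤ) :
    (diffStep α β)^[N] (fun _ => 1) (-k) = (diffStep α β)^[N] (fun _ => 1) k := by
  have hr : ∀ k, rate α β (-k) = rate α β k := fun k => by simp [rate]
  induction N generalizing k with
  | zero => rfl
  | succ N ih =>
    rw [Function.iterate_succ_apply', diffStep, diffStep, ih, hr,
      show -k - 1 = -(k + 1) by ring, show -k + 1 = -(k - 1) by ring, ih, ih, hr, hr]
    ring

/-- The second moments started from the constant `1` stay below the invariant vector and tend to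
it. The defect, multiplied by the rate, solves a heat equation started from a point mass. -/
lemma iterate_diffStep_one {α β : ℝ} (hβ : 0 < β) (hβα : β ≤ α) (hα : α ≤ 1 / 4) (k : ℤ) :
    (∀ N, (diffStep α β)^[N] (fun _ => 1) k ≤ invariantCov α β k) ∧
    Tendsto (fun N => (diffStep α β)^[N] (fun _ => 1) k) atTop (𝓝 (invariantCov α β k)) := by
  have hαp : 0 < α := hβ.trans_le hβα
  set b : ℕ → ℤ → ℝ := fun N => (diffStep α β)^[N] (fun _ => 1) with hb
  have hbs : ∀ N k, b (N + 1) k = diffStep α β (b N) k := fun N k => by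
    simp only [hb, Function.iterate_succ_apply']
  have hbneg : ∀ N k, b N (-k) = b N k := iterate_diffStep_one_neg α β
  let v : ℕ → ℕ → ℝ := fun N k => α - rate α β k * b N k
  have key : ∀ k : ℕ, (∀ n, 0 ≤ v n k) ∧ Tendsto (fun n => v n k) atTop (𝓝 0) := by
    refine tendsto_heat_zero hβ hβα hα v ?_ ?_ ?_ ?_
    · simp [v, b, rate]; exact hβα
    · intro k
      have : ((k : ℤ) + 1) ≠ 0 := by omega
      simp only [v, b, rate, Nat.cast_succ, this, if_false, Function.iterate_zero, id]
      ring
    · intro n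
      have h1 := hbneg n 1
      simp only [v, hbs, diffStep, rate]
      simp only [Nat.cast_zero, if_true, zero_sub, zero_add, neg_eq_zero, one_ne_zero, if_false,
        h1, Nat.cast_one]
      ring
    · intro n k
      have h1 : ((k : ℤ) + 1) ≠ 0 := by omega
      have h2 : ((k : ℤ) + 2) ≠ 0 := by omega
      simp only [v, hbs, diffStep]
      push_cast
      rw [show (k : ℤ) + 1 - 1 = k by ring, show (k : ℤ) + 1 + 1 = k + 2 by ring]
      simp only [rate, h1, h2, if_false]
      ring
  have hnat : ∀ k : ℕ, (∀ N, b N k ≤ invariantCov α β k) ∧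
      Tendsto (fun N => b N k) atTop (𝓝 (invariantCov α β k)) := by
    intro k
    have hr := rate_pos hαp hβ (k : ℤ)
    have hbv : ∀ N, b N k = invariantCov α β k - v N k / rate α β k := by
      intro N
      simp only [v, invariantCov]
      field_simp
      ring
    refine ⟨fun N => ?_, ?_⟩
    · rw [hbv]
      have := div_nonneg ((key k).1 N) hr.le
      linarith
    · simp only [hbv]
      have := ((key k).2.div_const (rate α β k)).const_sub (invariantCov α β k)
      simpa using this
  rcases Int.eq_nat_or_neg k with ⟨m, rfl | rfl⟩
  · exact hnat m
  · have : invariantCov α β (-(m : ℤ)) = invariantCov α β m := by simp [invariantCov, rate]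
    rw [this]
    change (∀ N, b N (-(m : ℤ)) ≤ _) ∧ Tendsto (fun N => b N (-(m : ℤ))) atTop _
    simpa only [hbneg] using hnat m

/-! ### Independence of the environment at different times -/

/-- The σ-algebra generated by the jump laws at the space-time points in `S`. -/
abbrev envSigma (R : ℕ) (S : Set (ℤ × ℤ)) : MeasurableSpace (Env R) :=
  ⨆ i ∈ S, MeasurableSpace.comap (fun ω : Env R => ω i) inferInstance

lemma envSigma_le {R : ℕ} (S : Set (ℤ × ℤ)) : envSigma R S ≤ MeasurableSpace.pi :=
  iSup₂_le fun i _ => (measurable_pi_apply i).comap_le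

lemma envSigma_mono {R : ℕ} {S T : Set (ℤ × ℤ)} (h : S ⊆ T) : envSigma R S ≤ envSigma R T :=
  biSup_mono h

lemma measurable_jump_envSigma {R : ℕ} {S : Set (ℤ × ℤ)} {i : ℤ × ℤ} (hi : i ∈ S) (z : ℤ) :
    Measurable[envSigma R S] fun ω : Env R => (ω i).1 z := by
  have h : Measurable[envSigma R S] fun ω : Env R => ω i :=
    Measurable.mono (comap_measurable _) (le_iSup₂_of_le i hi le_rfl) le_rfl
  exact ((measurable_pi_apply z).comp measurable_subtype_coe).comp h

lemma measurable_trans_envSigma {R : ℕ} {S : Set (ℤ × ℤ)} (n : ℕ) (s x y : ℤ)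
    (hS : ∀ i : ℤ × ℤ, s ≤ i.1 → i.1 < s + n → i ∈ S) :
    Measurable[envSigma R S] fun ω : Env R => trans ω n s x y := by
  induction n generalizing s x with
  | zero => exact measurable_const
  | succ n ih =>
    push_cast at hS
    exact Finset.measurable_fun_sum _ fun z _ => (measurable_jump_envSigma
      (hS _ le_rfl (by dsimp only; omega)) _).mul (ih _ _ fun i h1 h2 => hS i (by omega) (by omega))

lemma integral_mul_of_disjoint {R : ℕ} {P : Measure (Env R)}
    (hindep : iIndepFun (fun (i : ℤ × ℤ) (ω : Env R) => ω i) P) {S T : Set (ℤ × ℤ)}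
    (hST : Disjoint S T) {f g : Env R → ℝ} (hf : Measurable[envSigma R S] f)
    (hg : Measurable[envSigma R T] g) : ∫ ω, f ω * g ω ∂P = (∫ ω, f ω ∂P) * ∫ ω, g ω ∂P := by
  have hi : Indep (envSigma R S) (envSigma R T) P :=
    indep_iSup_of_disjoint (fun i => (measurable_pi_apply i).comap_le) hindep hST
  have hfg : IndepFun f g P :=
    indep_of_indep_of_le_right (indep_of_indep_of_le_left hi hf.comap_le) hg.comap_le
  exact hfg.integral_fun_mul_eq_mul_integral
    (hf.mono (envSigma_le S) le_rfl).aestronglyMeasurable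
    (hg.mono (envSigma_le T) le_rfl).aestronglyMeasurable

lemma abs_jump_le_one {R : ℕ} (v : JumpLaw R) (z : ℤ) : |v.1 z| ≤ 1 := by
  rw [abs_of_nonneg (v.2.1 z)]
  exact jump_le_one v z

lemma abs_trans_le_one {R : ℕ} (ω : Env R) (n : ℕ) (s x y : ℤ) : |trans ω n s x y| ≤ 1 := by
  rw [abs_of_nonneg (trans_nonneg ω n s x y)]
  exact trans_le_one ω n s x y

lemma integrable_jump {R : ℕ} (P : Measure (Env R)) [IsProbabilityMeasure P] (i : ℤ × ℤ) (z : ℤ) :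
    Integrable (fun ω : Env R => (ω i).1 z) P :=
  Integrable.of_bound (measurable_jump i z).aestronglyMeasurable 1
    (Eventually.of_forall fun _ => abs_jump_le_one _ _)

lemma integrable_jump_mul {R : ℕ} (P : Measure (Env R)) [IsProbabilityMeasure P]
    (i j : ℤ × ℤ) (z z' : ℤ) : Integrable (fun ω : Env R => (ω i).1 z * (ω j).1 z') P :=
  Integrable.of_bound ((measurable_jump i z).mul (measurable_jump j z')).aestronglyMeasurable 1
    (Eventually.of_forall fun _ => by
      rw [norm_mul]
      exact mul_le_one₀ (abs_jump_le_one _ _) (norm_nonneg _) (abs_jump_le_one _ _))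

lemma integrable_trans {R : ℕ} (P : Measure (Env R)) [IsProbabilityMeasure P] (n : ℕ)
    (s x y : ℤ) : Integrable (fun ω : Env R => trans ω n s x y) P :=
  Integrable.of_bound (measurable_trans n s x y).aestronglyMeasurable 1
    (Eventually.of_forall fun _ => abs_trans_le_one _ _ _ _ _)

lemma integrable_trans_mul {R : ℕ} (P : Measure (Env R)) [IsProbabilityMeasure P] (n : ℕ)
    (s x y u v : ℤ) : Integrable (fun ω : Env R => trans ω n s u x * trans ω n s v y) P :=
  Integrable.of_bound
    ((measurable_trans n s u x).mul (measurable_trans n s v y)).aestronglyMeasurable 1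
    (Eventually.of_forall fun _ => by
      rw [norm_mul]
      exact mul_le_one₀ (abs_trans_le_one _ _ _ _ _) (norm_nonneg _) (abs_trans_le_one _ _ _ _ _))

lemma measurable_jumpLaw_apply {R : ℕ} (z : ℤ) : Measurable fun v : JumpLaw R => v.1 z :=
  (measurable_pi_apply z).comp measurable_subtype_coe

section Moments

variable {R : ℕ} {P : Measure (Env R)}

lemma integral_jump (hident : ∀ i : ℤ × ℤ, IdentDistrib (fun ω : Env R => ω i)
    (fun ω => ω (0, 0)) P P) (i : ℤ × ℤ) (z : ℤ) : ∫ ω, (ω i).1 z ∂P = meanKernel P z :=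
  ((hident i).comp (measurable_jumpLaw_apply z)).integral_eq

lemma integral_jump_mul_self (hident : ∀ i : ℤ × ℤ, IdentDistrib (fun ω : Env R => ω i)
    (fun ω => ω (0, 0)) P P) (i : ℤ × ℤ) (z z' : ℤ) :
    ∫ ω, (ω i).1 z * (ω i).1 z' ∂P = ∫ ω, (ω (0, 0)).1 z * (ω (0, 0)).1 z' ∂P :=
  ((hident i).comp ((measurable_jumpLaw_apply z).mul (measurable_jumpLaw_apply z'))).integral_eq

lemma integral_jump_mul_of_ne (hindep : iIndepFun (fun (i : ℤ × ℤ) (ω : Env R) => ω i) P)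
    (hident : ∀ i : ℤ × ℤ, IdentDistrib (fun ω : Env R => ω i) (fun ω => ω (0, 0)) P P)
    {i j : ℤ × ℤ} (hij : i ≠ j) (z z' : ℤ) :
    ∫ ω, (ω i).1 z * (ω j).1 z' ∂P = meanKernel P z * meanKernel P z' := by
  rw [integral_mul_of_disjoint hindep (Set.disjoint_singleton.2 hij)
    (measurable_jump_envSigma (Set.mem_singleton i) z)
    (measurable_jump_envSigma (Set.mem_singleton j) z'), integral_jump hident,
    integral_jump hident]

lemma sum_meanKernel [IsProbabilityMeasure P] :
    ∑ z ∈ Finset.Icc (-(R : ℤ)) R, meanKernel P z = 1 := by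
  simp only [meanKernel]
  rw [← integral_finsetSum _ fun z _ => integrable_jump P (0, 0) z]
  have : ∀ ω : Env R, ∑ z ∈ Finset.Icc (-(R : ℤ)) R, (ω (0, 0)).1 z = 1 := fun ω => (ω _).2.2.2
  simp [this]

/-- The mass transported to `x` from a uniform unit mass has mean one. -/
lemma integral_sum_trans [IsProbabilityMeasure P]
    (hindep : iIndepFun (fun (i : ℤ × ℤ) (ω : Env R) => ω i) P)
    (hident : ∀ i : ℤ × ℤ, IdentDistrib (fun ω : Env R => ω i) (fun ω => ω (0, 0)) P P)
    (N : ℕ) (s x : ℤ) {S : Finset ℤ} (hS : window R N x ⊆ S) :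
    ∑ u ∈ S, ∫ ω, trans ω N s u x ∂P = 1 := by
  induction N generalizing x with
  | zero =>
    have hx : x ∈ S := hS (by simp [window])
    simp [trans, hx]
  | succ N ih =>
    have h1 : ∀ u, ∫ ω, trans ω (N + 1) s u x ∂P = ∑ z ∈ Finset.Icc (-(R : ℤ)) R,
        meanKernel P z * ∫ ω, trans ω N s u (x - z) ∂P := by
      intro u
      have h2 : ∀ z, ∫ ω, (ω (s + N, x - z)).1 z * trans ω N s u (x - z) ∂P =
          meanKernel P z * ∫ ω, trans ω N s u (x - z) ∂P := by
        intro z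
        rw [integral_mul_of_disjoint (S := {i | i.1 = s + N}) (T := {i | i.1 < s + N}) hindep
          (Set.disjoint_left.2 fun i hi hi' => (ne_of_lt hi') hi)
          (measurable_jump_envSigma (by simp) _)
          (measurable_trans_envSigma _ _ _ _ fun i _ h => h), integral_jump hident]
      simp only [trans_succ_last, ← h2]
      refine integral_finsetSum _ fun z _ => ?_
      refine Integrable.of_bound
        ((measurable_jump _ z).mul (measurable_trans N s u (x - z))).aestronglyMeasurable 1
        (Eventually.of_forall fun _ => ?_)
      rw [norm_mul]
      exact mul_le_one₀ (abs_jump_le_one _ _) (norm_nonneg _) (abs_trans_le_one _ _ _ _ _)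
    simp only [h1]
    rw [Finset.sum_comm]
    simp only [← Finset.mul_sum]
    refine Eq.trans ?_ (sum_meanKernel (P := P))
    refine Finset.sum_congr rfl fun z hz => ?_
    rw [ih _ ((window_sub_subset hz).trans hS), mul_one]

/-- Second moments of transported masses in terms of those one step earlier: condition on the
positions before the last step. -/
lemma integral_sum_sum_trans_succ [IsProbabilityMeasure P]
    (hindep : iIndepFun (fun (i : ℤ × ℤ) (ω : Env R) => ω i) P) (b : ℤ → ℤ → ℝ) (N : ℕ)
    (s x y : ℤ) (S S' : Finset ℤ) :
    ∫ ω, ∑ u ∈ S, ∑ v ∈ S', b u v * (trans ω (N + 1) s u x * trans ω (N + 1) s v y) ∂P =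
      ∑ i ∈ Finset.Icc (-(R : ℤ)) R ×ˢ Finset.Icc (-(R : ℤ)) R,
        (∫ ω, (ω (s + N, x - i.1)).1 i.1 * (ω (s + N, y - i.2)).1 i.2 ∂P) *
        ∫ ω, ∑ u ∈ S, ∑ v ∈ S', b u v * (trans ω N s u (x - i.1) * trans ω N s v (y - i.2)) ∂P := by
  set I := Finset.Icc (-(R : ℤ)) R
  have h1 : ∀ ω : Env R,
      ∑ u ∈ S, ∑ v ∈ S', b u v * (trans ω (N + 1) s u x * trans ω (N + 1) s v y) =
      ∑ i ∈ I ×ˢ I, ((ω (s + N, x - i.1)).1 i.1 * (ω (s + N, y - i.2)).1 i.2) *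
        ∑ u ∈ S, ∑ v ∈ S', b u v * (trans ω N s u (x - i.1) * trans ω N s v (y - i.2)) := by
    intro ω
    simp only [Finset.mul_sum]
    rw [Finset.sum_comm (s := I ×ˢ I)]
    refine Finset.sum_congr rfl fun u _ => ?_
    rw [Finset.sum_comm (s := I ×ˢ I)]
    refine Finset.sum_congr rfl fun v _ => ?_
    rw [trans_succ_last, trans_succ_last, Finset.sum_mul_sum, ← Finset.sum_product',
      Finset.mul_sum]
    refine Finset.sum_congr rfl fun i _ => ?_
    ring
  have hint : ∀ x y, Integrable (fun ω : Env R =>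
      ∑ u ∈ S, ∑ v ∈ S', b u v * (trans ω N s u x * trans ω N s v y)) P := fun x y =>
    integrable_finsetSum _ fun u _ => integrable_finsetSum _ fun v _ =>
      (integrable_trans_mul P N s x y u v).const_mul _
  simp only [h1]
  rw [integral_finsetSum]
  · refine Finset.sum_congr rfl fun i _ => ?_
    refine integral_mul_of_disjoint (S := {i | i.1 = s + N}) (T := {i | i.1 < s + N}) hindep
      (Set.disjoint_left.2 fun i hi hi' => (ne_of_lt hi') hi) ?_ ?_
    · exact (measurable_jump_envSigma (by simp) _).mul (measurable_jump_envSigma (by simp) _)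
    · exact Finset.measurable_fun_sum _ fun u _ => Finset.measurable_fun_sum _ fun v _ =>
        ((measurable_trans_envSigma _ _ _ _ fun i _ h => h).mul
          (measurable_trans_envSigma _ _ _ _ fun i _ h => h)).const_mul _
  · intro i _
    refine (hint _ _).bdd_mul (c := 1)
      ((measurable_jump _ _).mul (measurable_jump _ _)).aestronglyMeasurable
      (Eventually.of_forall fun ω => ?_)
    rw [norm_mul]
    exact mul_le_one₀ (abs_jump_le_one _ _) (norm_nonneg _) (abs_jump_le_one _ _)

/-! ### Jump laws on two adjacent sites -/

/-- The mean of the product of the jump probabilities to the two adjacent sites `a`, `a + 1`. -/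
def crossMoment (P : Measure (Env R)) (a : ℤ) : ℝ :=
  ∫ ω, (ω (0, 0)).1 a * (ω (0, 0)).1 (a + 1) ∂P

/-- The product of the mean jump probabilities to the two adjacent sites `a`, `a + 1`. -/
def meanProduct (P : Measure (Env R)) (a : ℤ) : ℝ := meanKernel P a * meanKernel P (a + 1)

lemma sum_jump_le_one (v : JumpLaw R) (A : Finset ℤ) : ∑ z ∈ A, v.1 z ≤ 1 := by
  refine le_of_le_of_eq ?_ v.2.2.2
  rw [Finset.sum_subset (Finset.subset_union_right (s₁ := A))
    fun z _ hz => jump_eq_zero_of_notMem v hz]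
  exact Finset.sum_le_sum_of_subset_of_nonneg Finset.subset_union_left fun z _ _ => v.2.1 z

lemma jump_add_jump_le_one (v : JumpLaw R) (a : ℤ) : v.1 a + v.1 (a + 1) ≤ 1 := by
  rw [← Finset.sum_pair (f := v.1) (show a ≠ a + 1 by omega)]
  exact sum_jump_le_one v _

lemma jump_eq_zero_of_add_eq_one {v : JumpLaw R} {a : ℤ} (h : v.1 a + v.1 (a + 1) = 1) {z : ℤ}
    (h1 : z ≠ a) (h2 : z ≠ a + 1) : v.1 z = 0 := by
  have h3 : v.1 z + (v.1 a + v.1 (a + 1)) ≤ 1 := by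
    rw [← Finset.sum_pair (f := v.1) (show a ≠ a + 1 by omega),
      ← Finset.sum_insert (f := v.1) (by simp [h1, h2])]
    exact sum_jump_le_one v _
  linarith [v.2.1 z]

lemma ae_jump_add_jump [IsProbabilityMeasure P] {a : ℤ}
    (ha : meanKernel P a + meanKernel P (a + 1) = 1) :
    ∀ᵐ ω ∂P, (ω (0, 0)).1 a + (ω (0, 0)).1 (a + 1) = 1 := by
  have hint : Integrable (fun ω : Env R => (ω (0, 0)).1 a + (ω (0, 0)).1 (a + 1)) P :=
    (integrable_jump P (0, 0) a).add (integrable_jump P (0, 0) (a + 1))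
  have h0 : ∫ ω : Env R, (1 - ((ω (0, 0)).1 a + (ω (0, 0)).1 (a + 1))) ∂P = 0 := by
    rw [integral_sub (integrable_const _) hint,
      integral_add (integrable_jump P _ _) (integrable_jump P _ _)]
    simp only [meanKernel] at ha
    simp [ha]
  rw [integral_eq_zero_iff_of_nonneg
    (fun ω => sub_nonneg.2 (jump_add_jump_le_one _ _)) ((integrable_const _).sub hint)] at h0
  filter_upwards [h0] with ω hω
  simp only [Pi.zero_apply] at hω
  linarith

lemma integral_jump_sq_left [IsProbabilityMeasure P] {a : ℤ}
    (ha : meanKernel P a + meanKernel P (a + 1) = 1) :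
    ∫ ω, (ω (0, 0)).1 a * (ω (0, 0)).1 a ∂P = meanKernel P a - crossMoment P a := by
  rw [meanKernel, crossMoment,
    ← integral_sub (integrable_jump P _ _) (integrable_jump_mul P _ _ _ _)]
  refine integral_congr_ae ?_
  filter_upwards [ae_jump_add_jump ha] with ω hω
  rw [← eq_sub_iff_add_eq'] at hω
  rw [hω]
  ring

lemma integral_jump_sq_right [IsProbabilityMeasure P] {a : ℤ}
    (ha : meanKernel P a + meanKernel P (a + 1) = 1) :
    ∫ ω, (ω (0, 0)).1 (a + 1) * (ω (0, 0)).1 (a + 1) ∂P =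
      meanKernel P (a + 1) - crossMoment P a := by
  rw [meanKernel, crossMoment,
    ← integral_sub (integrable_jump P _ _) (integrable_jump_mul P _ _ _ _)]
  refine integral_congr_ae ?_
  filter_upwards [ae_jump_add_jump ha] with ω hω
  rw [← eq_sub_iff_add_eq] at hω
  rw [hω]
  ring

lemma crossMoment_pos [IsProbabilityMeasure P] {a : ℤ}
    (ha : meanKernel P a + meanKernel P (a + 1) = 1)
    (hnondeg : 0 < P {ω | ∃ z : ℤ, 0 < (ω (0, 0)).1 z ∧ (ω (0, 0)).1 z < 1}) :
    0 < crossMoment P a := by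
  have hnn : 0 ≤ fun ω : Env R => (ω (0, 0)).1 a * (ω (0, 0)).1 (a + 1) := fun ω =>
    mul_nonneg ((ω _).2.1 _) ((ω _).2.1 _)
  rw [crossMoment, integral_pos_iff_support_of_nonneg hnn (integrable_jump_mul P _ _ _ _)]
  refine hnondeg.trans_le (measure_mono_ae ?_)
  filter_upwards [ae_jump_add_jump ha] with ω hω
  rintro ⟨z, hz0, hz1⟩
  have h1 : z = a ∨ z = a + 1 := by
    by_contra! h
    exact hz0.ne' (jump_eq_zero_of_add_eq_one hω h.1 h.2)
  change (ω (0, 0)).1 a * (ω (0, 0)).1 (a + 1) ≠ 0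
  rcases h1 with rfl | rfl
  · exact mul_ne_zero hz0.ne' (by linarith)
  · exact mul_ne_zero (by linarith) hz0.ne'

lemma crossMoment_le [IsProbabilityMeasure P] {a : ℤ}
    (ha : meanKernel P a + meanKernel P (a + 1) = 1) : crossMoment P a ≤ meanProduct P a := by
  have h := integral_jump_sq_left ha
  have hvar : 0 ≤ ∫ ω : Env R, ((ω (0, 0)).1 a - meanKernel P a) ^ 2 ∂P :=
    integral_nonneg fun _ => sq_nonneg _
  have h2 : ∫ ω : Env R, ((ω (0, 0)).1 a - meanKernel P a) ^ 2 ∂P =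
      (meanKernel P a - crossMoment P a) - meanKernel P a ^ 2 := by
    have : ∀ ω : Env R, ((ω (0, 0)).1 a - meanKernel P a) ^ 2 =
        (ω (0, 0)).1 a * (ω (0, 0)).1 a - 2 * meanKernel P a * (ω (0, 0)).1 a +
          meanKernel P a ^ 2 := fun ω => by ring
    simp only [this]
    have h3 : Integrable (fun ω : Env R => 2 * meanKernel P a * (ω (0, 0)).1 a) P :=
      (integrable_jump P _ _).const_mul _
    have h4 : Integrable (fun ω : Env R =>
        (ω (0, 0)).1 a * (ω (0, 0)).1 a - 2 * meanKernel P a * (ω (0, 0)).1 a) P :=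
      (integrable_jump_mul P _ _ _ _).sub h3
    rw [integral_add h4 (integrable_const _), integral_sub (integrable_jump_mul P _ _ _ _) h3, h,
      integral_const_mul, show ∫ ω : Env R, (ω (0, 0)).1 a ∂P = meanKernel P a from rfl]
    simp
    ring
  rw [meanProduct, eq_sub_of_add_eq' ha]
  nlinarith

lemma meanProduct_le {a : ℤ} (ha : meanKernel P a + meanKernel P (a + 1) = 1) :
    meanProduct P a ≤ 1 / 4 := by
  rw [meanProduct, eq_sub_of_add_eq' ha]
  nlinarith [sq_nonneg (meanKernel P a - 1 / 2)]

/-- Second moments of the masses which are transported to `x` and `y` from initial masses with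
second moments `b`: they follow the difference chain. -/
theorem integral_sum_sum_trans [IsProbabilityMeasure P]
    (hindep : iIndepFun (fun (i : ℤ × ℤ) (ω : Env R) => ω i) P)
    (hident : ∀ i : ℤ × ℤ, IdentDistrib (fun ω : Env R => ω i) (fun ω => ω (0, 0)) P P)
    {a : ℤ} (ha : meanKernel P a + meanKernel P (a + 1) = 1) (b : ℤ → ℝ) (N : ℕ) (s x y : ℤ)
    {S S' : Finset ℤ} (hS : window R N x ⊆ S) (hS' : window R N y ⊆ S') :
    ∫ ω, ∑ u ∈ S, ∑ v ∈ S', b (v - u) * (trans ω N s u x * trans ω N s v y) ∂P =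
      (diffStep (meanProduct P a) (crossMoment P a))^[N] b (y - x) := by
  induction N generalizing x y with
  | zero =>
    have hx : x ∈ S := hS (by simp [window])
    have hy : y ∈ S' := hS' (by simp [window])
    simp [trans, hx, hy]
  | succ N ih =>
    set B := (diffStep (meanProduct P a) (crossMoment P a))^[N] b with hB
    rw [integral_sum_sum_trans_succ hindep fun u v => b (v - u)]
    have h1 : ∀ i ∈ Finset.Icc (-(R : ℤ)) R ×ˢ Finset.Icc (-(R : ℤ)) R,
        (∫ ω, (ω (s + N, x - i.1)).1 i.1 * (ω (s + N, y - i.2)).1 i.2 ∂P) *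
        (∫ ω, ∑ u ∈ S, ∑ v ∈ S', b (v - u) *
          (trans ω N s u (x - i.1) * trans ω N s v (y - i.2)) ∂P) =
        (∫ ω, (ω (s + N, x - i.1)).1 i.1 * (ω (s + N, y - i.2)).1 i.2 ∂P) *
          B (y - i.2 - (x - i.1)) := by
      intro i hi
      rw [Finset.mem_product] at hi
      rw [ih _ _ ((window_sub_subset hi.1).trans hS) ((window_sub_subset hi.2).trans hS')]
    rw [Finset.sum_congr rfl h1]
    have hae : ∀ i : ℤ × ℤ, ∀ᵐ ω ∂P, (ω i).1 a + (ω i).1 (a + 1) = 1 := fun i =>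
      (hident i).symm.ae_snd (p := fun v : JumpLaw R => v.1 a + v.1 (a + 1) = 1)
        (measurableSet_eq_fun ((measurable_jumpLaw_apply a).add
          (measurable_jumpLaw_apply (a + 1))) measurable_const)
        (ae_jump_add_jump ha)
    rw [sum_eq_sum_of_eq_zero (B := ({a, a + 1} : Finset ℤ) ×ˢ {a, a + 1})]
    rotate_left
    · intro i hi
      rw [Finset.mem_product, not_and_or] at hi
      have : ∀ ω : Env R, (ω (s + N, x - i.1)).1 i.1 * (ω (s + N, y - i.2)).1 i.2 = 0 := by
        intro ω
        rcases hi with h | h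
        · rw [jump_eq_zero_of_notMem _ h, zero_mul]
        · rw [jump_eq_zero_of_notMem _ h, mul_zero]
      simp [this]
    · intro i hi
      simp only [Finset.mem_product, Finset.mem_insert, Finset.mem_singleton, not_and_or,
        not_or] at hi
      have : ∫ ω, (ω (s + N, x - i.1)).1 i.1 * (ω (s + N, y - i.2)).1 i.2 ∂P = 0 := by
        refine integral_eq_zero_of_ae ?_
        filter_upwards [hae (s + N, x - i.1), hae (s + N, y - i.2)] with ω h1 h2
        rcases hi with h | h
        · rw [jump_eq_zero_of_add_eq_one h1 h.1 h.2, zero_mul]; rfl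
        · rw [jump_eq_zero_of_add_eq_one h2 h.1 h.2, mul_zero]; rfl
      rw [this, zero_mul]
    have hne : a ≠ a + 1 := by omega
    rw [Finset.sum_product, Finset.sum_pair hne, Finset.sum_pair hne, Finset.sum_pair hne,
      Function.iterate_succ_apply', ← hB, diffStep,
      show y - a - (x - a) = y - x by ring, show y - (a + 1) - (x - a) = y - x - 1 by ring,
      show y - a - (x - (a + 1)) = y - x + 1 by ring,
      show y - (a + 1) - (x - (a + 1)) = y - x by ring]
    have hp : meanKernel P (a + 1) = 1 - meanKernel P a := eq_sub_of_add_eq' ha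
    -- the two walks use the same jump law exactly if they are at the same site before the step
    have hsite : ∀ z z' : ℤ, ∫ ω, (ω (s + N, x - z)).1 z * (ω (s + N, y - z')).1 z' ∂P =
        if y - x + (z - z') = 0 then ∫ ω, (ω (0, 0)).1 z * (ω (0, 0)).1 z' ∂P
        else meanKernel P z * meanKernel P z' := by
      intro z z'
      split_ifs with h
      · rw [show y - z' = x - z by linarith]
        exact integral_jump_mul_self hident _ _ _
      · refine integral_jump_mul_of_ne hindep hident (fun h' => h ?_) _ _
        rw [Prod.mk.injEq] at h'
        linarith [h'.2]
    have hswap : ∫ ω, (ω (0, 0)).1 (a + 1) * (ω (0, 0)).1 a ∂P = crossMoment P a := by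
      simp only [crossMoment, mul_comm]
    simp only [hsite, integral_jump_sq_left ha, integral_jump_sq_right ha, hswap]
    rw [show ∫ ω, (ω (0, 0)).1 a * (ω (0, 0)).1 (a + 1) ∂P = crossMoment P a from rfl]
    simp only [sub_self, add_zero, show a - (a + 1) = -1 by ring, show a + 1 - a = 1 by ring,
      ← sub_eq_add_neg, rate, mul_comm (meanKernel P (a + 1)) (meanKernel P a),
      show meanKernel P a * meanKernel P (a + 1) = meanProduct P a from rfl]
    by_cases h0 : y - x = 0
    · simp only [h0, if_true]
      rw [hp]
      ring
    · simp only [h0, if_false]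
      rw [meanProduct, hp]
      ring

end Moments

/-! ### Square integrable martingales -/

section Martingale

variable {Ω : Type*} {m0 : MeasurableSpace Ω} {μ : Measure Ω}

lemma eLpNorm_two_eq {g : Ω → ℝ} (hg : MemLp g 2 μ) :
    eLpNorm g 2 μ = ENNReal.ofReal (√(∫ ω, g ω ^ 2 ∂μ)) := by
  rw [hg.eLpNorm_eq_integral_rpow_norm two_ne_zero ENNReal.ofNat_ne_top]
  simp [Real.sqrt_eq_rpow]

/-- Inner products pass to the limit in `L²`. -/
lemma tendsto_integral_mul_of_tendsto_eLpNorm {f g : ℕ → Ω → ℝ} {f' g' : Ω → ℝ}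
    (hf : ∀ n, MemLp (f n) 2 μ) (hg : ∀ n, MemLp (g n) 2 μ) (hf' : MemLp f' 2 μ)
    (hg' : MemLp g' 2 μ) (hff : Tendsto (fun n => eLpNorm (f n - f') 2 μ) atTop (𝓝 0))
    (hgg : Tendsto (fun n => eLpNorm (g n - g') 2 μ) atTop (𝓝 0)) :
    Tendsto (fun n => ∫ ω, f n ω * g n ω ∂μ) atTop (𝓝 (∫ ω, f' ω * g' ω ∂μ)) := by
  have h1 := (Lp.tendsto_Lp_iff_tendsto_eLpNorm'' f hf f' hf').2 hff
  have h2 := (Lp.tendsto_Lp_iff_tendsto_eLpNorm'' g hg g' hg').2 hgg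
  have h3 : ∀ {u v : Ω → ℝ} (hu : MemLp u 2 μ) (hv : MemLp v 2 μ),
      inner ℝ (hu.toLp u) (hv.toLp v) = ∫ ω, u ω * v ω ∂μ := by
    intro u v hu hv
    rw [L2.inner_def]
    refine integral_congr_ae ?_
    filter_upwards [hu.coeFn_toLp, hv.coeFn_toLp] with ω hω1 hω2
    rw [hω1, hω2]
    simp [mul_comm]
  simpa only [h3] using h1.inner (𝕜 := ℝ) h2

lemma integral_mul_of_martingale [IsProbabilityMeasure μ] {ℱ : Filtration ℕ m0} {X : ℕ → Ω → ℝ}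
    (hX : Martingale X ℱ μ) (hL : ∀ n, MemLp (X n) 2 μ) {m n : ℕ} (hmn : m ≤ n) :
    ∫ ω, X m ω * X n ω ∂μ = ∫ ω, X m ω ^ 2 ∂μ := by
  have hint : Integrable (X m * X n) μ := (hL m).integrable_mul (hL n)
  have h1 : μ[X m * X n | ℱ m] =ᵐ[μ] X m * μ[X n | ℱ m] :=
    condExp_mul_of_stronglyMeasurable_left (hX.stronglyMeasurable m) hint (hX.integrable n)
  calc ∫ ω, X m ω * X n ω ∂μ = ∫ ω, (μ[X m * X n | ℱ m]) ω ∂μ :=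
        (integral_condExp (ℱ.le m)).symm
    _ = ∫ ω, X m ω ^ 2 ∂μ := by
        refine integral_congr_ae ?_
        filter_upwards [h1, hX.2 m n hmn] with ω hω1 hω2
        rw [hω1, Pi.mul_apply, hω2, sq]

/-- A martingale with bounded second moments converges almost surely and in `L²`. -/
theorem tendsto_of_martingale_of_sq_le [IsProbabilityMeasure μ] {ℱ : Filtration ℕ m0}
    {X : ℕ → Ω → ℝ} (hX : Martingale X ℱ μ) (hL : ∀ n, MemLp (X n) 2 μ) {C : ℝ}
    (hC : ∀ n, ∫ ω, X n ω ^ 2 ∂μ ≤ C) :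
    (∀ᵐ ω ∂μ, Tendsto (fun n => X n ω) atTop (𝓝 (limsup (fun n => X n ω) atTop))) ∧
    MemLp (fun ω => limsup (fun n => X n ω) atTop) 2 μ ∧
    Tendsto (fun n => eLpNorm (X n - fun ω => limsup (fun n => X n ω) atTop) 2 μ) atTop
      (𝓝 0) := by
  set f : Ω → ℝ := fun ω => limsup (fun n => X n ω) atTop with hf
  have hbdd : ∀ n, eLpNorm (X n) 1 μ ≤ ((√C).toNNReal : ℝ≥0∞) := fun n => by
    refine (eLpNorm_le_eLpNorm_of_exponent_le one_le_two (hL n).1).trans ?_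
    rw [eLpNorm_two_eq (hL n)]
    exact ENNReal.ofReal_le_ofReal (Real.sqrt_le_sqrt (hC n))
  have hlim : ∀ᵐ ω ∂μ, Tendsto (fun n => X n ω) atTop (𝓝 (f ω)) := by
    filter_upwards [hX.submartingale.exists_ae_tendsto_of_bdd hbdd] with ω ⟨c, hc⟩
    rw [hf]
    dsimp only
    rwa [hc.limsup_eq]
  -- orthogonality of the increments
  have hsq : ∀ m n, m ≤ n → ∫ ω, (X m ω - X n ω) ^ 2 ∂μ =
      ∫ ω, X n ω ^ 2 ∂μ - ∫ ω, X m ω ^ 2 ∂μ := by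
    intro m n hmn
    have h1 : Integrable (fun ω => X m ω * X n ω) μ := (hL m).integrable_mul (hL n)
    have h2 : Integrable (fun ω => X m ω ^ 2 - 2 * (X m ω * X n ω)) μ :=
      (hL m).integrable_sq.sub (h1.const_mul 2)
    have h3 : ∀ ω, (X m ω - X n ω) ^ 2 =
      X m ω ^ 2 - 2 * (X m ω * X n ω) + X n ω ^ 2 := fun ω => by ring
    simp only [h3]
    rw [integral_add h2 (hL n).integrable_sq, integral_sub (hL m).integrable_sq (h1.const_mul 2),
      integral_const_mul, integral_mul_of_martingale hX hL hmn]
    ring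
  have hmono : Monotone fun n => ∫ ω, X n ω ^ 2 ∂μ := fun m n hmn => by
    have : 0 ≤ ∫ ω, (X m ω - X n ω) ^ 2 ∂μ := integral_nonneg fun _ => sq_nonneg _
    rw [hsq m n hmn] at this
    exact sub_nonneg.1 this
  obtain ⟨l, hl⟩ : ∃ l, Tendsto (fun n => ∫ ω, X n ω ^ 2 ∂μ) atTop (𝓝 l) :=
    ⟨_, tendsto_atTop_ciSup hmono ⟨C, by rintro _ ⟨n, rfl⟩; exact hC n⟩⟩
  have hle : ∀ m, eLpNorm (X m - f) 2 μ ≤ ENNReal.ofReal (√(l - ∫ ω, X m ω ^ 2 ∂μ)) := by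
    intro m
    refine (Lp.eLpNorm_lim_le_liminf_eLpNorm (f := fun n => X m - X n)
      (fun n => ((hL m).sub (hL n)).1) (X m - f) ?_).trans ?_
    · filter_upwards [hlim] with ω hω
      exact hω.const_sub _
    · refine liminf_le_of_frequently_le' (Eventually.frequently ?_)
      filter_upwards [eventually_ge_atTop m] with n hn
      rw [eLpNorm_two_eq ((hL m).sub (hL n))]
      refine ENNReal.ofReal_le_ofReal (Real.sqrt_le_sqrt ?_)
      simp only [Pi.sub_apply]
      rw [hsq m n hn]
      exact sub_le_sub_right (hmono.ge_of_tendsto hl n) _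
  have hmeas : AEStronglyMeasurable f μ :=
    aestronglyMeasurable_of_tendsto_ae atTop (fun n => (hL n).1) hlim
  have hf2 : MemLp f 2 μ := by
    have h1 : MemLp (X 0 - f) 2 μ := ⟨(hL 0).1.sub hmeas, (hle 0).trans_lt ENNReal.ofReal_lt_top⟩
    have := (hL 0).sub h1
    rwa [sub_sub_cancel] at this
  refine ⟨hlim, hf2, ?_⟩
  refine tendsto_of_tendsto_of_tendsto_of_le_of_le tendsto_const_nhds ?_
    (fun n => zero_le) hle
  have h1 : Tendsto (fun m => ENNReal.ofReal (√(l - ∫ ω, X m ω ^ 2 ∂μ))) atTop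
      (𝓝 (ENNReal.ofReal (√(l - l)))) :=
    (ENNReal.continuous_ofReal.comp Real.continuous_sqrt).continuousAt.tendsto.comp
      (hl.const_sub l)
  simpa using h1

end Martingale

/-! ### The density as a martingale limit -/

section Density

variable {R : ℕ} {P : Measure (Env R)}

/-- The filtration of the past of time `0`, revealed backwards in time. -/
def pastFiltration (R : ℕ) : Filtration ℕ (MeasurableSpace.pi : MeasurableSpace (Env R)) where
  seq N := envSigma R {i | -(N : ℤ) ≤ i.1 ∧ i.1 < 0}
  mono' _ _ h := envSigma_mono fun _ hi =>
    ⟨(neg_le_neg (by exact_mod_cast h)).trans hi.1, hi.2⟩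
  le' _ := envSigma_le _

lemma measurable_preDensity_shift_past (N : ℕ) (x : ℤ) :
    Measurable[pastFiltration R N] fun ω : Env R => preDensity N (shift 0 x ω) := by
  simp only [preDensity_shift]
  exact Finset.measurable_fun_sum _ fun u _ => measurable_trans_envSigma _ _ _ _
    fun i h1 h2 => ⟨h1, by omega⟩

lemma memLp_preDensity_shift [IsProbabilityMeasure P] (N : ℕ) (x : ℤ) :
    MemLp (fun ω : Env R => preDensity N (shift 0 x ω)) 2 P := by
  refine MemLp.of_bound ((measurable_preDensity N).comp
    (measurable_shift 0 x)).aestronglyMeasurable (window R N x).card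
    (Eventually.of_forall fun ω => ?_)
  rw [preDensity_shift]
  refine (norm_sum_le _ _).trans ?_
  refine (Finset.sum_le_sum fun u _ => abs_trans_le_one ω N (-(N : ℤ)) u x).trans ?_
  simp

/-- The masses transported to `(0, x)` from time `-N` form a martingale in `N`: the jump
probabilities into a given site from time `-N - 1` have a sum of mean one, which is independent of
the environment after that time. -/
lemma martingale_preDensity_shift [IsProbabilityMeasure P]
    (hindep : iIndepFun (fun (i : ℤ × ℤ) (ω : Env R) => ω i) P)
    (hident : ∀ i : ℤ × ℤ, IdentDistrib (fun ω : Env R => ω i) (fun ω => ω (0, 0)) P P) (x : ℤ) :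
    Martingale (fun N (ω : Env R) => preDensity N (shift 0 x ω)) (pastFiltration R) P := by
  refine martingale_nat (fun N => (measurable_preDensity_shift_past N x).stronglyMeasurable)
    (fun N => (memLp_preDensity_shift N x).integrable one_le_two) fun N => ?_
  set A : ℤ → Env R → ℝ := fun y ω =>
    ∑ z ∈ Finset.Icc (-(R : ℤ)) R, (ω (-((N + 1 : ℕ) : ℤ), y - z)).1 z with hA
  have hdec : (fun ω : Env R => preDensity (N + 1) (shift 0 x ω)) =
      ∑ y ∈ window R N x, A y * fun ω => trans ω N (-(N : ℤ)) y x := by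
    funext ω
    rw [preDensity_shift, sum_trans_succ_first, Finset.sum_apply]
    refine Finset.sum_congr rfl fun y _ => ?_
    rw [show -((N + 1 : ℕ) : ℤ) + 1 = -(N : ℤ) by push_cast; ring]
    rfl
  have hAint : ∀ y, Integrable (A y) P := fun y =>
    integrable_finsetSum _ fun z _ => integrable_jump P _ z
  have hAmean : ∀ y, ∫ ω, A y ω ∂P = 1 := by
    intro y
    rw [integral_finsetSum _ fun z _ => integrable_jump P _ z]
    simp only [integral_jump hident]
    exact sum_meanKernel
  have hprod : ∀ y, Integrable (A y * fun ω => trans ω N (-(N : ℤ)) y x) P := fun y =>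
    (hAint y).mul_bdd (c := 1) (measurable_trans _ _ _ _).aestronglyMeasurable
      (Eventually.of_forall fun ω => abs_trans_le_one ω _ _ _ _)
  have hcond : ∀ y, P[A y * fun ω => trans ω N (-(N : ℤ)) y x | pastFiltration R N] =ᵐ[P]
      fun ω => trans ω N (-(N : ℤ)) y x := by
    intro y
    have h1 : P[A y * fun ω => trans ω N (-(N : ℤ)) y x | pastFiltration R N] =ᵐ[P]
        P[A y | pastFiltration R N] * fun ω => trans ω N (-(N : ℤ)) y x :=
      condExp_mul_of_stronglyMeasurable_right
        (Measurable.stronglyMeasurable (measurable_trans_envSigma _ _ _ _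
          fun i h1 h2 => ⟨h1, by omega⟩)) (hprod y) (hAint y)
    have h2 : P[A y | pastFiltration R N] =ᵐ[P] fun _ => ∫ ω, A y ω ∂P := by
      refine condExp_indep_eq (m₁ := envSigma R {i | i.1 = -((N + 1 : ℕ) : ℤ)})
        (envSigma_le _) ((pastFiltration R).le N) ?_ ?_
      · exact Measurable.stronglyMeasurable
          (Finset.measurable_fun_sum _ fun z _ => measurable_jump_envSigma (by simp) z)
      · refine indep_iSup_of_disjoint (fun i => (measurable_pi_apply i).comap_le) hindep
          (Set.disjoint_left.2 fun i hi hi' => ?_)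
        have h1 : i.1 = -((N + 1 : ℕ) : ℤ) := hi
        have h2 : -(N : ℤ) ≤ i.1 := hi'.1
        push_cast at h1
        omega
    filter_upwards [h1, h2] with ω hω1 hω2
    rw [hω1, Pi.mul_apply, hω2, hAmean, one_mul]
  rw [hdec]
  have hsum := condExp_finsetSum (μ := P) (s := window R N x) (fun y _ => hprod y)
    (pastFiltration R N)
  filter_upwards [hsum, (Filter.eventually_all_finset (window R N x)).2 fun y _ => hcond y]
    with ω hω1 hω2
  rw [hω1, Finset.sum_apply, preDensity_shift]
  exact Finset.sum_congr rfl fun y hy => (hω2 y hy).symm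

lemma integral_preDensity_shift [IsProbabilityMeasure P]
    (hindep : iIndepFun (fun (i : ℤ × ℤ) (ω : Env R) => ω i) P)
    (hident : ∀ i : ℤ × ℤ, IdentDistrib (fun ω : Env R => ω i) (fun ω => ω (0, 0)) P P)
    (N : ℕ) (x : ℤ) : ∫ ω : Env R, preDensity N (shift 0 x ω) ∂P = 1 := by
  simp only [preDensity_shift]
  rw [integral_finsetSum _ fun u _ => integrable_trans P _ _ _ _]
  exact integral_sum_trans hindep hident N _ x subset_rfl

lemma integral_preDensity_mul [IsProbabilityMeasure P]
    (hindep : iIndepFun (fun (i : ℤ × ℤ) (ω : Env R) => ω i) P)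
    (hident : ∀ i : ℤ × ℤ, IdentDistrib (fun ω : Env R => ω i) (fun ω => ω (0, 0)) P P)
    {a : ℤ} (ha : meanKernel P a + meanKernel P (a + 1) = 1) (N : ℕ) (x y : ℤ) :
    ∫ ω : Env R, preDensity N (shift 0 x ω) * preDensity N (shift 0 y ω) ∂P =
      (diffStep (meanProduct P a) (crossMoment P a))^[N] (fun _ => 1) (y - x) := by
  rw [← integral_sum_sum_trans hindep hident ha (fun _ => 1) N (-(N : ℤ)) x y
    (subset_refl (window R N x)) (subset_refl (window R N y))]
  simp only [preDensity_shift, one_mul, Finset.sum_mul_sum]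

/-- At every site, the transported masses converge to the density almost surely and in `L²`. -/
theorem tendsto_preDensity_shift [IsProbabilityMeasure P]
    (hindep : iIndepFun (fun (i : ℤ × ℤ) (ω : Env R) => ω i) P)
    (hident : ∀ i : ℤ × ℤ, IdentDistrib (fun ω : Env R => ω i) (fun ω => ω (0, 0)) P P)
    (hnondeg : 0 < P {ω | ∃ z : ℤ, 0 < (ω (0, 0)).1 z ∧ (ω (0, 0)).1 z < 1})
    {a : ℤ} (ha : meanKernel P a + meanKernel P (a + 1) = 1) (x : ℤ) :
    (∀ᵐ ω ∂P, Tendsto (fun N => preDensity N (shift 0 x ω)) atTop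
      (𝓝 (density (shift 0 x ω)))) ∧
    MemLp (fun ω : Env R => density (shift 0 x ω)) 2 P ∧
    Tendsto (fun N => eLpNorm ((fun ω : Env R => preDensity N (shift 0 x ω)) -
      fun ω => density (shift 0 x ω)) 2 P) atTop (𝓝 0) := by
  refine tendsto_of_martingale_of_sq_le (martingale_preDensity_shift hindep hident x)
    (fun N => memLp_preDensity_shift N x)
    (C := invariantCov (meanProduct P a) (crossMoment P a) (x - x)) fun N => ?_
  simp only [sq]
  rw [integral_preDensity_mul hindep hident ha]
  exact (iterate_diffStep_one (crossMoment_pos ha hnondeg) (crossMoment_le ha)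
    (meanProduct_le ha) (x - x)).1 N

lemma integral_density_shift [IsProbabilityMeasure P]
    (hindep : iIndepFun (fun (i : ℤ × ℤ) (ω : Env R) => ω i) P)
    (hident : ∀ i : ℤ × ℤ, IdentDistrib (fun ω : Env R => ω i) (fun ω => ω (0, 0)) P P)
    (hnondeg : 0 < P {ω | ∃ z : ℤ, 0 < (ω (0, 0)).1 z ∧ (ω (0, 0)).1 z < 1})
    {a : ℤ} (ha : meanKernel P a + meanKernel P (a + 1) = 1) (x : ℤ) :
    ∫ ω : Env R, density (shift 0 x ω) ∂P = 1 := by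
  obtain ⟨-, h2, h3⟩ := tendsto_preDensity_shift hindep hident hnondeg ha x
  have h := tendsto_integral_mul_of_tendsto_eLpNorm (g := fun _ _ => 1) (g' := fun _ => 1)
    (fun N => memLp_preDensity_shift N x) (fun _ => memLp_const 1) h2 (memLp_const 1) h3 (by simp)
  simp only [mul_one, integral_preDensity_shift hindep hident] at h
  exact (tendsto_nhds_unique h tendsto_const_nhds)

lemma integral_density_mul [IsProbabilityMeasure P]
    (hindep : iIndepFun (fun (i : ℤ × ℤ) (ω : Env R) => ω i) P)
    (hident : ∀ i : ℤ × ℤ, IdentDistrib (fun ω : Env R => ω i) (fun ω => ω (0, 0)) P P)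
    (hnondeg : 0 < P {ω | ∃ z : ℤ, 0 < (ω (0, 0)).1 z ∧ (ω (0, 0)).1 z < 1})
    {a : ℤ} (ha : meanKernel P a + meanKernel P (a + 1) = 1) (x y : ℤ) :
    ∫ ω : Env R, density (shift 0 x ω) * density (shift 0 y ω) ∂P =
      invariantCov (meanProduct P a) (crossMoment P a) (y - x) := by
  obtain ⟨-, h2, h3⟩ := tendsto_preDensity_shift hindep hident hnondeg ha x
  obtain ⟨-, h2', h3'⟩ := tendsto_preDensity_shift hindep hident hnondeg ha y
  have h := tendsto_integral_mul_of_tendsto_eLpNorm (fun N => memLp_preDensity_shift N x)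
    (fun N => memLp_preDensity_shift N y) h2 h2' h3 h3'
  simp only [integral_preDensity_mul hindep hident ha] at h
  exact tendsto_nhds_unique h (iterate_diffStep_one (crossMoment_pos ha hnondeg)
    (crossMoment_le ha) (meanProduct_le ha) (y - x)).2

lemma ae_density_shift_nonneg [IsProbabilityMeasure P]
    (hindep : iIndepFun (fun (i : ℤ × ℤ) (ω : Env R) => ω i) P)
    (hident : ∀ i : ℤ × ℤ, IdentDistrib (fun ω : Env R => ω i) (fun ω => ω (0, 0)) P P)
    (hnondeg : 0 < P {ω | ∃ z : ℤ, 0 < (ω (0, 0)).1 z ∧ (ω (0, 0)).1 z < 1})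
    {a : ℤ} (ha : meanKernel P a + meanKernel P (a + 1) = 1) (x : ℤ) :
    ∀ᵐ ω ∂P, 0 ≤ density (shift 0 x ω) := by
  filter_upwards [(tendsto_preDensity_shift hindep hident hnondeg ha x).1] with ω hω
  refine ge_of_tendsto' hω fun N => ?_
  rw [preDensity_shift]
  exact Finset.sum_nonneg fun u _ => trans_nonneg _ _ _ _ _

end Density

/-! ### Moments of the stationary measure -/

/-- The factorial moments of a Poisson variable. -/
lemma lintegral_descFactorial_poissonMeasure (r : ℝ≥0) (k : ℕ) :
    ∫⁻ n, (n.descFactorial k : ℝ≥0∞) ∂poissonMeasure r = (r : ℝ≥0∞) ^ k := by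
  have hnn : ∀ n : ℕ, 0 ≤ Real.exp (-r) * (r : ℝ) ^ n / n.factorial := fun n => by positivity
  have hterm : ∀ n : ℕ, (n.descFactorial k : ℝ≥0∞) * poissonMeasure r {n} =
      ENNReal.ofReal (n.descFactorial k * (Real.exp (-r) * (r : ℝ) ^ n / n.factorial)) := by
    intro n
    rw [poissonMeasure_singleton, ENNReal.ofReal_mul (Nat.cast_nonneg _), ENNReal.ofReal_natCast]
  have hsum : HasSum (fun n : ℕ => n.descFactorial k *
      (Real.exp (-r) * (r : ℝ) ^ n / n.factorial)) ((r : ℝ) ^ k) := by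
    rw [← hasSum_nat_add_iff' k, Finset.sum_eq_zero, sub_zero]
    · have h := (hasSum_one_poissonMeasure r).mul_left ((r : ℝ) ^ k)
      rw [mul_one] at h
      refine h.congr_fun fun m => ?_
      have hf : ((m + k).factorial : ℝ) = m.factorial * (m + k).descFactorial k := by
        have := Nat.factorial_mul_descFactorial (Nat.le_add_left k m)
        rw [Nat.add_sub_cancel] at this
        exact_mod_cast this.symm
      have hd : ((m + k).descFactorial k : ℝ) ≠ 0 := by
        have : (m + k).descFactorial k ≠ 0 := by
          rw [Ne, Nat.descFactorial_eq_zero_iff_lt]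
          omega
        exact_mod_cast this
      rw [hf, pow_add]
      field_simp
    · intro n hn
      rw [Nat.descFactorial_of_lt (Finset.mem_range.1 hn)]
      simp
  rw [lintegral_countable']
  simp only [hterm]
  rw [← ENNReal.ofReal_tsum_of_nonneg (fun n => mul_nonneg (Nat.cast_nonneg _) (hnn n))
    hsum.summable, hsum.tsum_eq, ENNReal.ofReal_pow r.coe_nonneg, ENNReal.ofReal_coe_nnreal]

/-- The number of ordered pairs of distinct particles at `u` and `v`. -/
def pairCount (u v : ℤ) (η : Config) : ℕ := if u = v then (η u).descFactorial 2 else η u * η v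

section Poisson

variable {R : ℕ}

instance (ρ : ℝ≥0) (ω : Env R) : IsProbabilityMeasure (quenchedPoisson ρ ω) := by
  unfold quenchedPoisson
  infer_instance

lemma lintegral_quenchedPoisson_apply (ρ : ℝ≥0) (ω : Env R) (x : ℤ) (g : ℕ → ℝ≥0∞) :
    ∫⁻ η, g (η x) ∂quenchedPoisson ρ ω =
      ∫⁻ n, g n ∂poissonMeasure (ρ * (density (shift 0 x ω)).toNNReal) := by
  rw [quenchedPoisson, ← Measure.infinitePi_map_eval
    (fun x : ℤ => poissonMeasure (ρ * (density (shift 0 x ω)).toNNReal)) x,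
    lintegral_map (measurable_of_countable g) (measurable_pi_apply x)]

lemma lintegral_quenchedPoisson_pairCount (ρ : ℝ≥0) (ω : Env R) (u v : ℤ) :
    ∫⁻ η, (pairCount u v η : ℝ≥0∞) ∂quenchedPoisson ρ ω =
      ((ρ * (density (shift 0 u ω)).toNNReal : ℝ≥0) : ℝ≥0∞) *
        ((ρ * (density (shift 0 v ω)).toNNReal : ℝ≥0) : ℝ≥0∞) := by
  by_cases h : u = v
  · subst h
    simp only [pairCount, if_true]
    rw [lintegral_quenchedPoisson_apply ρ ω u fun n => (n.descFactorial 2 : ℝ≥0∞),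
      lintegral_descFactorial_poissonMeasure, sq]
  · have h1 := fun x => lintegral_quenchedPoisson_apply ρ ω x fun n => (n : ℝ≥0∞)
    have h2 := fun r => lintegral_descFactorial_poissonMeasure r 1
    simp only [Nat.descFactorial_one, pow_one] at h2
    simp only [pairCount, h, if_false, Nat.cast_mul]
    rw [← h2, ← h2, ← h1 u, ← h1 v]
    have hm : Measurable fun n : ℕ => (n : ℝ≥0∞) := measurable_of_countable _
    have hi : IndepFun (fun η : Config => η u) (fun η => η v) (quenchedPoisson ρ ω) :=
      (iIndepFun_infinitePi (X := fun _ n => n) fun _ => measurable_id).indepFun h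
    exact lintegral_mul_eq_lintegral_mul_lintegral_of_indepFun
      (hm.comp (measurable_pi_apply u)) (hm.comp (measurable_pi_apply v)) (hi.comp hm hm)

variable {P : Measure (Env R)}

lemma measurable_natCast_apply (x : ℤ) : Measurable fun η : Config => (η x : ℝ≥0∞) :=
  (measurable_of_countable fun n : ℕ => (n : ℝ≥0∞)).comp (measurable_pi_apply x)

lemma measurable_pairCount (u v : ℤ) : Measurable fun η : Config => (pairCount u v η : ℝ≥0∞) := by
  by_cases h : u = v
  · simp only [pairCount, h, if_true]
    exact (measurable_of_countable fun n : ℕ => (n.descFactorial 2 : ℝ≥0∞)).comp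
      (measurable_pi_apply v)
  · simp only [pairCount, h, if_false, Nat.cast_mul]
    exact (measurable_natCast_apply u).mul (measurable_natCast_apply v)

lemma lintegral_stationaryMeasure_apply [IsProbabilityMeasure P]
    (hindep : iIndepFun (fun (i : ℤ × ℤ) (ω : Env R) => ω i) P)
    (hident : ∀ i : ℤ × ℤ, IdentDistrib (fun ω : Env R => ω i) (fun ω => ω (0, 0)) P P)
    (hnondeg : 0 < P {ω | ∃ z : ℤ, 0 < (ω (0, 0)).1 z ∧ (ω (0, 0)).1 z < 1})
    {a : ℤ} (ha : meanKernel P a + meanKernel P (a + 1) = 1) (ρ : ℝ≥0) (x : ℤ) :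
    ∫⁻ η, (η x : ℝ≥0∞) ∂stationaryMeasure P ρ = ρ := by
  rw [stationaryMeasure, Measure.lintegral_bind (measurable_quenchedPoisson ρ).aemeasurable
    (measurable_natCast_apply x).aemeasurable]
  have h1 : ∀ ω : Env R, ∫⁻ η, (η x : ℝ≥0∞) ∂quenchedPoisson ρ ω =
      ρ * ENNReal.ofReal (density (shift 0 x ω)) := by
    intro ω
    have h2 := lintegral_descFactorial_poissonMeasure (ρ * (density (shift 0 x ω)).toNNReal) 1
    simp only [Nat.descFactorial_one, pow_one] at h2
    rw [lintegral_quenchedPoisson_apply ρ ω x fun n => (n : ℝ≥0∞), h2, ENNReal.coe_mul]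
    rfl
  simp only [h1]
  rw [lintegral_const_mul' _ _ ENNReal.coe_ne_top, ← ofReal_integral_eq_lintegral_ofReal
    ((tendsto_preDensity_shift hindep hident hnondeg ha x).2.1.integrable one_le_two)
    (ae_density_shift_nonneg hindep hident hnondeg ha x),
    integral_density_shift hindep hident hnondeg ha, ENNReal.ofReal_one, mul_one]

lemma lintegral_stationaryMeasure_pairCount [IsProbabilityMeasure P]
    (hindep : iIndepFun (fun (i : ℤ × ℤ) (ω : Env R) => ω i) P)
    (hident : ∀ i : ℤ × ℤ, IdentDistrib (fun ω : Env R => ω i) (fun ω => ω (0, 0)) P P)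
    (hnondeg : 0 < P {ω | ∃ z : ℤ, 0 < (ω (0, 0)).1 z ∧ (ω (0, 0)).1 z < 1})
    {a : ℤ} (ha : meanKernel P a + meanKernel P (a + 1) = 1) (ρ : ℝ≥0) (u v : ℤ) :
    ∫⁻ η, (pairCount u v η : ℝ≥0∞) ∂stationaryMeasure P ρ = (ρ : ℝ≥0∞) ^ 2 *
      ENNReal.ofReal (invariantCov (meanProduct P a) (crossMoment P a) (v - u)) := by
  rw [stationaryMeasure, Measure.lintegral_bind (measurable_quenchedPoisson ρ).aemeasurable
    (measurable_pairCount u v).aemeasurable]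
  have hu := ae_density_shift_nonneg hindep hident hnondeg ha u
  have hv := ae_density_shift_nonneg hindep hident hnondeg ha v
  have h1 : ∀ᵐ ω ∂P, ∫⁻ η, (pairCount u v η : ℝ≥0∞) ∂quenchedPoisson ρ ω =
      (ρ : ℝ≥0∞) ^ 2 * ENNReal.ofReal (density (shift 0 u ω) * density (shift 0 v ω)) := by
    filter_upwards [hu] with ω hω
    rw [lintegral_quenchedPoisson_pairCount, ENNReal.ofReal_mul hω, ENNReal.coe_mul,
      ENNReal.coe_mul, sq]
    change _ * ENNReal.ofReal _ * (_ * ENNReal.ofReal _) = _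
    ring
  rw [lintegral_congr_ae h1, lintegral_const_mul' _ _ (by simp),
    ← ofReal_integral_eq_lintegral_ofReal, integral_density_mul hindep hident hnondeg ha]
  · exact (tendsto_preDensity_shift hindep hident hnondeg ha u).2.1.integrable_mul
      (tendsto_preDensity_shift hindep hident hnondeg ha v).2.1
  · filter_upwards [hu, hv] with ω h1 h2 using mul_nonneg h1 h2

lemma memLp_two_natCast {Ω : Type*} {m0 : MeasurableSpace Ω} {μ : Measure Ω} {X : Ω → ℕ}
    (hX : AEMeasurable X μ) (h : ∫⁻ ω, (X ω : ℝ≥0∞) * X ω ∂μ ≠ ∞) :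
    MemLp (fun ω => (X ω : ℝ)) 2 μ := by
  have hm : AEMeasurable (fun ω => (X ω : ℝ)) μ :=
    (measurable_of_countable fun n : ℕ => (n : ℝ)).comp_aemeasurable hX
  refine ⟨hm.aestronglyMeasurable, ?_⟩
  rw [eLpNorm_lt_top_iff_lintegral_rpow_enorm_lt_top two_ne_zero ENNReal.ofNat_ne_top]
  refine lt_of_eq_of_lt (lintegral_congr fun ω => ?_) h.lt_top
  simp [sq, Real.enorm_natCast]

lemma lintegral_stationaryMeasure_mul_self_ne_top [IsProbabilityMeasure P]
    (hindep : iIndepFun (fun (i : ℤ × ℤ) (ω : Env R) => ω i) P)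
    (hident : ∀ i : ℤ × ℤ, IdentDistrib (fun ω : Env R => ω i) (fun ω => ω (0, 0)) P P)
    (hnondeg : 0 < P {ω | ∃ z : ℤ, 0 < (ω (0, 0)).1 z ∧ (ω (0, 0)).1 z < 1})
    {a : ℤ} (ha : meanKernel P a + meanKernel P (a + 1) = 1) (ρ : ℝ≥0) (x : ℤ) :
    ∫⁻ η, (η x : ℝ≥0∞) * η x ∂stationaryMeasure P ρ ≠ ∞ := by
  have h1 : ∀ η : Config, (η x : ℝ≥0∞) * η x = pairCount x x η + η x := by
    intro η
    have : η x * η x = pairCount x x η + η x := by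
      simp only [pairCount, if_true]
      cases h : η x with
      | zero => simp
      | succ n => simp [Nat.descFactorial]; ring
    exact_mod_cast this
  simp only [h1]
  rw [lintegral_add_left (measurable_pairCount x x),
    lintegral_stationaryMeasure_pairCount hindep hident hnondeg ha,
    lintegral_stationaryMeasure_apply hindep hident hnondeg ha]
  exact ENNReal.add_ne_top.2
    ⟨ENNReal.mul_ne_top (by simp) ENNReal.ofReal_ne_top, ENNReal.coe_ne_top⟩

lemma memLp_stationaryMeasure_apply [IsProbabilityMeasure P]
    (hindep : iIndepFun (fun (i : ℤ × ℤ) (ω : Env R) => ω i) P)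
    (hident : ∀ i : ℤ × ℤ, IdentDistrib (fun ω : Env R => ω i) (fun ω => ω (0, 0)) P P)
    (hnondeg : 0 < P {ω | ∃ z : ℤ, 0 < (ω (0, 0)).1 z ∧ (ω (0, 0)).1 z < 1})
    {a : ℤ} (ha : meanKernel P a + meanKernel P (a + 1) = 1) (ρ : ℝ≥0) (x : ℤ) :
    MemLp (fun η : Config => (η x : ℝ)) 2 (stationaryMeasure P ρ) :=
  memLp_two_natCast (measurable_pi_apply x).aemeasurable
    (lintegral_stationaryMeasure_mul_self_ne_top hindep hident hnondeg ha ρ x)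

/-- Two counting variables of mean `m` are uncorrelated if their product has mean `m²`. -/
lemma covariance_natCast_eq_zero {Ω : Type*} {m0 : MeasurableSpace Ω} {μ : Measure Ω}
    [IsProbabilityMeasure μ] {X Y : Ω → ℕ} {m : ℝ≥0} (hX : MemLp (fun ω => (X ω : ℝ)) 2 μ)
    (hY : MemLp (fun ω => (Y ω : ℝ)) 2 μ) (hXm : ∫⁻ ω, (X ω : ℝ≥0∞) ∂μ = m)
    (hYm : ∫⁻ ω, (Y ω : ℝ≥0∞) ∂μ = m)
    (hXY : ∫⁻ ω, (X ω : ℝ≥0∞) * Y ω ∂μ = (m : ℝ≥0∞) ^ 2) :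
    covariance (fun ω => (X ω : ℝ)) (fun ω => (Y ω : ℝ)) μ = 0 := by
  have h1 : ∀ {Z : Ω → ℕ}, AEStronglyMeasurable (fun ω => (Z ω : ℝ)) μ →
      ∫ ω, (Z ω : ℝ) ∂μ = (∫⁻ ω, (Z ω : ℝ≥0∞) ∂μ).toReal := by
    intro Z hZ
    rw [integral_eq_lintegral_of_nonneg_ae (Eventually.of_forall fun _ => Nat.cast_nonneg _) hZ]
    simp only [ENNReal.ofReal_natCast]
  have h2 : ∫ ω, ((X ω * Y ω : ℕ) : ℝ) ∂μ = (m : ℝ) ^ 2 := by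
    have hm : AEStronglyMeasurable (fun ω => ((X ω * Y ω : ℕ) : ℝ)) μ := by
      simp only [Nat.cast_mul]
      exact hX.1.mul hY.1
    rw [h1 hm]
    simp only [Nat.cast_mul]
    rw [hXY]
    simp
  rw [covariance_eq_sub hX hY, h1 hX.1, h1 hY.1, hXm, hYm]
  simp only [Pi.mul_apply, ← Nat.cast_mul]
  rw [h2]
  simp [sq]

lemma covariance_stationaryMeasure [IsProbabilityMeasure P]
    (hindep : iIndepFun (fun (i : ℤ × ℤ) (ω : Env R) => ω i) P)
    (hident : ∀ i : ℤ × ℤ, IdentDistrib (fun ω : Env R => ω i) (fun ω => ω (0, 0)) P P)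
    (hnondeg : 0 < P {ω | ∃ z : ℤ, 0 < (ω (0, 0)).1 z ∧ (ω (0, 0)).1 z < 1})
    {a : ℤ} (ha : meanKernel P a + meanKernel P (a + 1) = 1) (ρ : ℝ≥0) {x y : ℤ} (hxy : x ≠ y) :
    covariance (fun η : Config => (η x : ℝ)) (fun η => (η y : ℝ)) (stationaryMeasure P ρ) = 0 := by
  refine covariance_natCast_eq_zero (m := ρ)
    (memLp_stationaryMeasure_apply hindep hident hnondeg ha ρ x)
    (memLp_stationaryMeasure_apply hindep hident hnondeg ha ρ y)
    (lintegral_stationaryMeasure_apply hindep hident hnondeg ha ρ x)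
    (lintegral_stationaryMeasure_apply hindep hident hnondeg ha ρ y) ?_
  have h := lintegral_stationaryMeasure_pairCount hindep hident hnondeg ha ρ x y
  simp only [pairCount, hxy, if_false, Nat.cast_mul] at h
  rw [h, invariantCov_of_ne ((crossMoment_pos ha hnondeg).trans_le (crossMoment_le ha))
    (sub_ne_zero.2 hxy.symm), ENNReal.ofReal_one, mul_one]

end Poisson

/-! ### Quenched walks -/

section Walks

variable {R : ℕ}

lemma stepLaw_singleton (v : JumpLaw R) (x y : ℤ) : stepLaw v x {y} =
    ∑ z ∈ Finset.Icc (-(R : ℤ)) R, ENNReal.ofReal (v.1 z) * ({y - z} : Set ℤ).indicator 1 x := by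
  simp only [stepLaw, Measure.coe_finsetSum, Finset.sum_apply, Measure.smul_apply, smul_eq_mul]
  refine Finset.sum_congr rfl fun z _ => ?_
  rw [Measure.dirac_apply' _ (measurableSet_singleton y)]
  congr 1
  simp only [Set.indicator, Set.mem_singleton_iff, eq_sub_iff_add_eq]
  rfl

/-- The one-dimensional distributions of the quenched walk are its transition probabilities. -/
lemma walkLaw_apply (ω : Env R) (u : ℤ) (n : ℕ) (y : ℤ) :
    walkLaw ω u {X | X n = y} = ENNReal.ofReal (trans ω n 0 u y) := by
  induction n generalizing y with
  | zero =>
    have h1 : {X : ℕ → ℤ | X 0 = y} = Preorder.frestrictLe (π := fun _ => ℤ) 0 ⁻¹'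
        {h | h ⟨0, Finset.mem_Iic.2 le_rfl⟩ = y} := rfl
    have hm : MeasurableSet {h : Finset.Iic 0 → ℤ | h ⟨0, Finset.mem_Iic.2 le_rfl⟩ = y} :=
      measurable_pi_apply (X := fun _ : Finset.Iic 0 => ℤ) _ (measurableSet_singleton y)
    rw [h1, walkLaw, ← Measure.map_apply (by fun_prop) hm, Kernel.traj_map_frestrictLe_apply,
      Kernel.partialTraj_self, Kernel.id_apply, Measure.dirac_apply' _ hm]
    by_cases h : u = y <;> simp [trans, h]
  | succ n ih =>
    have hm : MeasurableSet {X : ℕ → ℤ | X (n + 1) = y} :=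
      measurable_pi_apply (X := fun _ : ℕ => ℤ) (n + 1) (measurableSet_singleton y)
    have hcond : ∀ h, Kernel.traj (X := fun _ => ℤ) (walkKernel ω) n h {X | X (n + 1) = y} =
        walkKernel ω n h {y} := by
      intro h
      rw [← Kernel.map_traj_succ_self (X := fun _ => ℤ) (κ := walkKernel ω),
        Kernel.map_apply' _ (by fun_prop) _ (measurableSet_singleton y)]
      rfl
    have hstep : walkLaw ω u {X | X (n + 1) = y} =
        ∫⁻ X, stepLaw (ω (n, X n)) (X n) {y} ∂walkLaw ω u := by
      have h1 : ∫⁻ X, stepLaw (ω (n, X n)) (X n) {y} ∂walkLaw ω u =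
          ∫⁻ h, walkKernel ω n h {y}
            ∂Kernel.partialTraj (X := fun _ => ℤ) (walkKernel ω) 0 n fun _ => u := by
        rw [← Kernel.traj_map_frestrictLe_apply, lintegral_map
          (Kernel.measurable_coe _ (measurableSet_singleton y)) (by fun_prop)]
        rfl
      rw [h1, walkLaw, ← Kernel.traj_comp_partialTraj (X := fun _ => ℤ) (Nat.zero_le n),
        Kernel.comp_apply' _ _ _ hm]
      simp only [hcond]
    rw [hstep]
    simp only [stepLaw_singleton]
    rw [lintegral_finsetSum' _ fun z _ => ?_, trans_succ_last,
      ENNReal.ofReal_sum_of_nonneg fun z _ => mul_nonneg ((ω _).2.1 z) (trans_nonneg _ _ _ _ _)]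
    · refine Finset.sum_congr rfl fun z _ => ?_
      have h2 : ∀ X : ℕ → ℤ, ENNReal.ofReal ((ω (n, X n)).1 z) *
          ({y - z} : Set ℤ).indicator 1 (X n) = ENNReal.ofReal ((ω (n, y - z)).1 z) *
          ({X : ℕ → ℤ | X n = y - z}).indicator 1 X := by
        intro X
        by_cases h : X n = y - z <;> simp [Set.indicator, h]
      have hm' : MeasurableSet {X : ℕ → ℤ | X n = y - z} :=
        measurable_pi_apply (X := fun _ : ℕ => ℤ) n (measurableSet_singleton (y - z))
      simp only [h2]
      rw [lintegral_const_mul' _ _ ENNReal.ofReal_ne_top, lintegral_indicator_one hm', ih,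
        ENNReal.ofReal_mul ((ω _).2.1 z), zero_add]
    · exact ((measurable_of_countable fun x : ℤ => ENNReal.ofReal ((ω (n, x)).1 z) *
        ({y - z} : Set ℤ).indicator 1 x).comp (measurable_pi_apply n)).aemeasurable

lemma measurableSet_position (i : ℤ × ℕ) (s : ℕ) (x : ℤ) :
    MeasurableSet {X : Paths | X i s = x} :=
  (measurable_pi_apply (X := fun _ : ℕ => ℤ) s).comp
    (measurable_pi_apply (X := fun _ : ℤ × ℕ => ℕ → ℤ) i) (measurableSet_singleton x)

lemma quenchedWalks_apply (ω : Env R) (i : ℤ × ℕ) (s : ℕ) (x : ℤ) :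
    quenchedWalks ω {X | X i s = x} = ENNReal.ofReal (trans ω s 0 i.1 x) := by
  have hm : MeasurableSet {X : ℕ → ℤ | X s = x} :=
    measurable_pi_apply (X := fun _ : ℕ => ℤ) s (measurableSet_singleton x)
  rw [← walkLaw_apply, ← Measure.infinitePi_map_eval (fun i : ℤ × ℕ => walkLaw ω i.1) i,
    Measure.map_apply (measurable_pi_apply i) hm]
  rfl

lemma quenchedWalks_inter_apply (ω : Env R) {i j : ℤ × ℕ} (hij : i ≠ j) (s : ℕ) (x y : ℤ) :
    quenchedWalks ω ({X | X i s = x} ∩ {X | X j s = y}) =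
      ENNReal.ofReal (trans ω s 0 i.1 x) * ENNReal.ofReal (trans ω s 0 j.1 y) := by
  have hi : IndepFun (fun X : Paths => X i s) (fun X => X j s) (quenchedWalks ω) :=
    (iIndepFun_infinitePi (P := fun i : ℤ × ℕ => walkLaw ω i.1) (X := fun _ X => X s)
      fun _ => measurable_pi_apply s).indepFun hij
  have := hi.measure_inter_preimage_eq_mul {x} {y} (measurableSet_singleton x)
    (measurableSet_singleton y)
  rw [← quenchedWalks_apply, ← quenchedWalks_apply]
  exact this

/-- The number of particles at `x` at time `s` among those started within reach of `x`. -/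
def localOccupation (R s : ℕ) (x : ℤ) (c : Config × Paths) : ℕ :=
  ∑ u ∈ window R s x, ∑ j ∈ Finset.range (c.1 u), if c.2 (u, j) s = x then 1 else 0

lemma measurable_localOccupation (s : ℕ) (x : ℤ) :
    Measurable (localOccupation R s x) := by
  refine Finset.measurable_fun_sum _ fun u _ => ?_
  have h1 : Measurable fun p : ℕ × Paths =>
      ∑ j ∈ Finset.range p.1, if p.2 (u, j) s = x then 1 else 0 := by
    refine measurable_from_prod_countable_right fun n => ?_
    have h : Measurable fun X : Paths =>
        ∑ j ∈ Finset.range n, if X (u, j) s = x then 1 else 0 :=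
      Finset.measurable_fun_sum _ fun j _ =>
        Measurable.ite (measurableSet_position (u, j) s x) measurable_const measurable_const
    exact h
  have h2 : Measurable fun c : Config × Paths => (c.1 u, c.2) :=
    ((measurable_pi_apply u).comp measurable_fst).prodMk measurable_snd
  exact h1.comp h2

variable {P : Measure (Env R)} {μ : Measure Config}

lemma lintegral_particleLaw [IsProbabilityMeasure μ] {g : Config × Paths → ℝ≥0∞}
    (hg : Measurable g) : ∫⁻ c, g c ∂particleLaw P μ =
      ∫⁻ ω, ∫⁻ η, ∫⁻ X, g (η, X) ∂quenchedWalks ω ∂μ ∂P := by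
  rw [particleLaw, Measure.lintegral_bind (measurable_prod_quenchedWalks μ).aemeasurable
    hg.aemeasurable]
  exact lintegral_congr fun ω => lintegral_prod _ hg.aemeasurable

/-- Almost surely, only particles started within reach of `x` contribute to the occupation. -/
lemma occupation_ae_eq [IsProbabilityMeasure P] [IsProbabilityMeasure μ] (s : ℕ) (x : ℤ) :
    (fun c => occupation s x c) =ᵐ[particleLaw P μ] localOccupation R s x := by
  have hzero : ∀ i : ℤ × ℕ, i.1 ∉ window R s x →
      ∀ᵐ c ∂particleLaw P μ, c.2 i s ≠ x := by
    intro i hi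
    have hm : MeasurableSet {c : Config × Paths | c.2 i s = x} :=
      measurable_snd (measurableSet_position i s x)
    have h0 : particleLaw P μ {c | c.2 i s = x} = 0 := by
      rw [← lintegral_indicator_one hm, lintegral_particleLaw (measurable_one.indicator hm)]
      have h1 : ∀ (ω : Env R) (η : Config), ∫⁻ X, ({c : Config × Paths | c.2 i s = x}).indicator
          1 (η, X) ∂quenchedWalks ω = 0 := by
        intro ω η
        have : quenchedWalks ω {X | X i s = x} = 0 := by
          rw [quenchedWalks_apply, trans_eq_zero_of_notMem _ _ hi, ENNReal.ofReal_zero]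
        rw [← this, ← lintegral_indicator_one (measurableSet_position i s x)]
        rfl
      simp [h1]
    exact measure_eq_zero_iff_ae_notMem.1 h0
  have hall : ∀ᵐ c ∂particleLaw P μ, ∀ i : ℤ × ℕ, i.1 ∉ window R s x → c.2 i s ≠ x := by
    rw [ae_all_iff]
    intro i
    by_cases hi : i.1 ∈ window R s x
    · exact Eventually.of_forall fun _ h => absurd hi h
    · filter_upwards [hzero i hi] with c hc _ using hc
  filter_upwards [hall] with c hc
  refine tsum_eq_sum fun u hu => Finset.sum_eq_zero fun j _ => ?_
  rw [if_neg (hc (u, j) hu)]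

lemma natCast_ite_eq_indicator (i : ℤ × ℕ) (s : ℕ) (x : ℤ) (X : Paths) :
    (((if X i s = x then 1 else 0 : ℕ) : ℕ) : ℝ≥0∞) = ({X : Paths | X i s = x}).indicator 1 X := by
  by_cases h : X i s = x <;> simp [Set.indicator, h]

/-- The quenched mean of the occupation, given the initial configuration. -/
lemma lintegral_quenchedWalks_localOccupation (ω : Env R) (η : Config) (s : ℕ) (x : ℤ) :
    ∫⁻ X, (localOccupation R s x (η, X) : ℝ≥0∞) ∂quenchedWalks ω =
      ∑ u ∈ window R s x, (η u : ℝ≥0∞) * ENNReal.ofReal (trans ω s 0 u x) := by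
  simp only [localOccupation, Nat.cast_sum, natCast_ite_eq_indicator]
  have hm : ∀ i : ℤ × ℕ, Measurable fun X : Paths =>
      ({X : Paths | X i s = x}).indicator (1 : Paths → ℝ≥0∞) X := fun i =>
    measurable_one.indicator (measurableSet_position i s x)
  rw [lintegral_finsetSum _ fun u _ => Finset.measurable_fun_sum _ fun j _ => hm _]
  refine Finset.sum_congr rfl fun u _ => ?_
  rw [lintegral_finsetSum _ fun j _ => hm _]
  simp [lintegral_indicator_one (measurableSet_position _ s x), quenchedWalks_apply]

lemma sum_sum_range_ne (n : ℕ) (c : ℝ≥0∞) :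
    ∑ j ∈ Finset.range n, ∑ k ∈ Finset.range n, (if j = k then 0 else c) =
      (n.descFactorial 2 : ℝ≥0∞) * c := by
  have h1 : ∀ j ∈ Finset.range n, ∑ k ∈ Finset.range n, (if j = k then 0 else c) =
      ((n - 1 : ℕ) : ℝ≥0∞) * c := by
    intro j hj
    rw [← Finset.sum_erase (Finset.range n) (a := j) (by simp),
      Finset.sum_congr rfl fun k hk => if_neg (Finset.ne_of_mem_erase hk).symm,
      Finset.sum_const, Finset.card_erase_of_mem hj, Finset.card_range, nsmul_eq_mul]
  rw [Finset.sum_congr rfl h1, Finset.sum_const, Finset.card_range, nsmul_eq_mul, ← mul_assoc,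
    ← Nat.cast_mul]
  congr 2
  cases n with
  | zero => rfl
  | succ n => simp [Nat.descFactorial]; ring

/-- The quenched mean of the product of the occupations of two sites, given the initial
configuration. A particle does not form a pair with itself, since it is not at both sites. -/
lemma lintegral_quenchedWalks_localOccupation_mul (ω : Env R) (η : Config) (s : ℕ) {x y : ℤ}
    (hxy : x ≠ y) :
    ∫⁻ X, (localOccupation R s x (η, X) : ℝ≥0∞) * localOccupation R s y (η, X)
        ∂quenchedWalks ω =
      ∑ u ∈ window R s x, ∑ v ∈ window R s y, (pairCount u v η : ℝ≥0∞) *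
        (ENNReal.ofReal (trans ω s 0 u x) * ENNReal.ofReal (trans ω s 0 v y)) := by
  simp only [localOccupation, Nat.cast_sum, natCast_ite_eq_indicator, Finset.sum_mul_sum]
  have hm : ∀ i j : ℤ × ℕ, Measurable fun X : Paths =>
      ({X : Paths | X i s = x}).indicator (1 : Paths → ℝ≥0∞) X *
        ({X : Paths | X j s = y}).indicator 1 X := fun i j =>
    (measurable_one.indicator (measurableSet_position i s x)).mul
      (measurable_one.indicator (measurableSet_position j s y))
  have hpair : ∀ i j : ℤ × ℕ, ∫⁻ X, ({X : Paths | X i s = x}).indicator (1 : Paths → ℝ≥0∞) X *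
      ({X : Paths | X j s = y}).indicator 1 X ∂quenchedWalks ω =
      if i = j then 0 else
        ENNReal.ofReal (trans ω s 0 i.1 x) * ENNReal.ofReal (trans ω s 0 j.1 y) := by
    intro i j
    have h1 : ∀ X : Paths, ({X : Paths | X i s = x}).indicator (1 : Paths → ℝ≥0∞) X *
        ({X : Paths | X j s = y}).indicator 1 X =
        ({X : Paths | X i s = x} ∩ {X | X j s = y}).indicator 1 X := by
      intro X
      rw [Set.inter_indicator_one]
      rfl
    simp only [h1]
    rw [lintegral_indicator_one
      ((measurableSet_position i s x).inter (measurableSet_position j s y))]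
    split_ifs with h
    · subst h
      have : {X : Paths | X i s = x} ∩ {X | X i s = y} = ∅ := by
        ext X
        simp only [Set.mem_inter_iff, Set.mem_ofPred_eq, Set.mem_empty_iff_false, iff_false,
          not_and]
        rintro rfl
        exact hxy
      rw [this, measure_empty]
    · exact quenchedWalks_inter_apply ω h s x y
  rw [lintegral_finsetSum _ fun u _ => Finset.measurable_fun_sum _ fun v _ =>
    Finset.measurable_fun_sum _ fun j _ => Finset.measurable_fun_sum _ fun k _ => hm _ _]
  refine Finset.sum_congr rfl fun u _ => ?_
  rw [lintegral_finsetSum _ fun v _ =>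
    Finset.measurable_fun_sum _ fun j _ => Finset.measurable_fun_sum _ fun k _ => hm _ _]
  refine Finset.sum_congr rfl fun v _ => ?_
  rw [lintegral_finsetSum _ fun j _ => Finset.measurable_fun_sum _ fun k _ => hm _ _]
  have h2 : ∀ j, ∫⁻ X, ∑ k ∈ Finset.range (η v),
      ({X : Paths | X (u, j) s = x}).indicator (1 : Paths → ℝ≥0∞) X *
        ({X : Paths | X (v, k) s = y}).indicator 1 X ∂quenchedWalks ω =
      ∑ k ∈ Finset.range (η v), if (u, j) = (v, k) then 0 else
        ENNReal.ofReal (trans ω s 0 u x) * ENNReal.ofReal (trans ω s 0 v y) := by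
    intro j
    rw [lintegral_finsetSum _ fun k _ => hm _ _]
    simp only [hpair]
  simp only [h2]
  by_cases h : u = v
  · subst h
    simp only [Prod.mk.injEq, true_and, pairCount, if_true]
    exact sum_sum_range_ne _ _
  · simp [pairCount, h, mul_assoc]

end Walks

/-! ### Occupation variables at a fixed time -/

section Occupation

variable {R : ℕ} {P : Measure (Env R)}

lemma memLp_occupation [IsProbabilityMeasure P]
    (hindep : iIndepFun (fun (i : ℤ × ℤ) (ω : Env R) => ω i) P)
    (hident : ∀ i : ℤ × ℤ, IdentDistrib (fun ω : Env R => ω i) (fun ω => ω (0, 0)) P P)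
    (hnondeg : 0 < P {ω | ∃ z : ℤ, 0 < (ω (0, 0)).1 z ∧ (ω (0, 0)).1 z < 1})
    {a : ℤ} (ha : meanKernel P a + meanKernel P (a + 1) = 1) (ρ : ℝ≥0) (s : ℕ) (x : ℤ) :
    MemLp (fun c => (occupation s x c : ℝ)) 2 (particleLaw P (stationaryMeasure P ρ)) := by
  have hinit : ∀ u : ℤ, MemLp (fun c : Config × Paths => (c.1 u : ℝ)) 2
      (particleLaw P (stationaryMeasure P ρ)) := by
    intro u
    refine memLp_two_natCast ((measurable_pi_apply u).comp measurable_fst).aemeasurable ?_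
    have hm : Measurable fun c : Config × Paths => (c.1 u : ℝ≥0∞) * c.1 u :=
      ((measurable_natCast_apply u).mul (measurable_natCast_apply u)).comp measurable_fst
    rw [lintegral_particleLaw hm]
    simpa using lintegral_stationaryMeasure_mul_self_ne_top hindep hident hnondeg ha ρ u
  have hloc : MemLp (fun c => (localOccupation R s x c : ℝ)) 2
      (particleLaw P (stationaryMeasure P ρ)) := by
    refine (memLp_finsetSum (window R s x) fun u _ => hinit u).mono
      ((measurable_of_countable fun n : ℕ => (n : ℝ)).comp
        (measurable_localOccupation s x)).aestronglyMeasurable (Eventually.of_forall fun c => ?_)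
    have hle : localOccupation R s x c ≤ ∑ u ∈ window R s x, c.1 u := by
      refine Finset.sum_le_sum fun u _ => (Finset.sum_le_card_nsmul _ _ 1 fun j _ => ?_).trans ?_
      · split_ifs <;> simp
      · simp
    rw [Real.norm_natCast, Real.norm_of_nonneg (Finset.sum_nonneg fun u _ => Nat.cast_nonneg _)]
    exact_mod_cast hle
  refine hloc.ae_eq ?_
  filter_upwards [occupation_ae_eq (P := P) (μ := stationaryMeasure P ρ) s x] with c hc
  rw [hc]

lemma lintegral_occupation [IsProbabilityMeasure P]
    (hindep : iIndepFun (fun (i : ℤ × ℤ) (ω : Env R) => ω i) P)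
    (hident : ∀ i : ℤ × ℤ, IdentDistrib (fun ω : Env R => ω i) (fun ω => ω (0, 0)) P P)
    (hnondeg : 0 < P {ω | ∃ z : ℤ, 0 < (ω (0, 0)).1 z ∧ (ω (0, 0)).1 z < 1})
    {a : ℤ} (ha : meanKernel P a + meanKernel P (a + 1) = 1) (ρ : ℝ≥0) (s : ℕ) (x : ℤ) :
    ∫⁻ c, (occupation s x c : ℝ≥0∞) ∂particleLaw P (stationaryMeasure P ρ) = ρ := by
  have h1 : ∫⁻ c, (occupation s x c : ℝ≥0∞) ∂particleLaw P (stationaryMeasure P ρ) =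
      ∫⁻ c, (localOccupation R s x c : ℝ≥0∞) ∂particleLaw P (stationaryMeasure P ρ) := by
    refine lintegral_congr_ae ?_
    filter_upwards [occupation_ae_eq (P := P) (μ := stationaryMeasure P ρ) s x] with c hc
    rw [hc]
  have hm : Measurable fun c => (localOccupation R s x c : ℝ≥0∞) :=
    (measurable_of_countable fun n : ℕ => (n : ℝ≥0∞)).comp (measurable_localOccupation s x)
  rw [h1, lintegral_particleLaw hm]
  simp only [lintegral_quenchedWalks_localOccupation]
  have h2 : ∀ ω : Env R, ∫⁻ η, ∑ u ∈ window R s x,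
      (η u : ℝ≥0∞) * ENNReal.ofReal (trans ω s 0 u x) ∂stationaryMeasure P ρ =
      ρ * ENNReal.ofReal (∑ u ∈ window R s x, trans ω s 0 u x) := by
    intro ω
    rw [lintegral_finsetSum _ fun u _ => (measurable_natCast_apply u).mul_const _,
      ENNReal.ofReal_sum_of_nonneg fun u _ => trans_nonneg _ _ _ _ _, Finset.mul_sum]
    refine Finset.sum_congr rfl fun u _ => ?_
    rw [lintegral_mul_const' _ _ ENNReal.ofReal_ne_top,
      lintegral_stationaryMeasure_apply hindep hident hnondeg ha]
  simp only [h2]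
  rw [lintegral_const_mul' _ _ ENNReal.coe_ne_top, ← ofReal_integral_eq_lintegral_ofReal
    (integrable_finsetSum _ fun u _ => integrable_trans P s 0 u x)
    (Eventually.of_forall fun ω => Finset.sum_nonneg fun u _ => trans_nonneg _ _ _ _ _),
    integral_finsetSum _ fun u _ => integrable_trans P s 0 u x,
    integral_sum_trans hindep hident s 0 x subset_rfl, ENNReal.ofReal_one, mul_one]

/-- Factorial pair moments of the initial law are the invariant vector of the difference chain, so
that transport by the walks in an independent environment does not change them. -/
lemma lintegral_occupation_mul [IsProbabilityMeasure P]
    (hindep : iIndepFun (fun (i : ℤ × ℤ) (ω : Env R) => ω i) P)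
    (hident : ∀ i : ℤ × ℤ, IdentDistrib (fun ω : Env R => ω i) (fun ω => ω (0, 0)) P P)
    (hnondeg : 0 < P {ω | ∃ z : ℤ, 0 < (ω (0, 0)).1 z ∧ (ω (0, 0)).1 z < 1})
    {a : ℤ} (ha : meanKernel P a + meanKernel P (a + 1) = 1) (ρ : ℝ≥0) (s : ℕ) {x y : ℤ}
    (hxy : x ≠ y) :
    ∫⁻ c, (occupation s x c : ℝ≥0∞) * occupation s y c ∂particleLaw P (stationaryMeasure P ρ) =
      (ρ : ℝ≥0∞) ^ 2 := by
  have hβ := crossMoment_pos ha hnondeg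
  have hα := hβ.trans_le (crossMoment_le ha)
  set F := invariantCov (meanProduct P a) (crossMoment P a) with hF
  have hFnn : ∀ k, 0 ≤ F k := fun k => div_nonneg hα.le (rate_pos hα hβ k).le
  have h1 : ∫⁻ c, (occupation s x c : ℝ≥0∞) * occupation s y c
        ∂particleLaw P (stationaryMeasure P ρ) =
      ∫⁻ c, (localOccupation R s x c : ℝ≥0∞) * localOccupation R s y c
        ∂particleLaw P (stationaryMeasure P ρ) := by
    refine lintegral_congr_ae ?_
    filter_upwards [occupation_ae_eq (P := P) (μ := stationaryMeasure P ρ) s x,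
      occupation_ae_eq (P := P) (μ := stationaryMeasure P ρ) s y] with c hc hc'
    rw [hc, hc']
  have hm : ∀ x, Measurable fun c => (localOccupation R s x c : ℝ≥0∞) := fun x =>
    (measurable_of_countable fun n : ℕ => (n : ℝ≥0∞)).comp (measurable_localOccupation s x)
  have hmul : Measurable fun c => (localOccupation R s x c : ℝ≥0∞) * localOccupation R s y c :=
    (hm x).mul (hm y)
  rw [h1, lintegral_particleLaw hmul]
  simp only [lintegral_quenchedWalks_localOccupation_mul _ _ s hxy]
  have h2 : ∀ ω : Env R, ∫⁻ η, ∑ u ∈ window R s x, ∑ v ∈ window R s y,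
      (pairCount u v η : ℝ≥0∞) * (ENNReal.ofReal (trans ω s 0 u x) *
        ENNReal.ofReal (trans ω s 0 v y)) ∂stationaryMeasure P ρ =
      (ρ : ℝ≥0∞) ^ 2 * ENNReal.ofReal (∑ u ∈ window R s x, ∑ v ∈ window R s y,
        F (v - u) * (trans ω s 0 u x * trans ω s 0 v y)) := by
    intro ω
    have hnn : ∀ u v, 0 ≤ F (v - u) * (trans ω s 0 u x * trans ω s 0 v y) := fun u v =>
      mul_nonneg (hFnn _) (mul_nonneg (trans_nonneg _ _ _ _ _) (trans_nonneg _ _ _ _ _))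
    rw [lintegral_finsetSum _ fun u _ => Finset.measurable_fun_sum _ fun v _ =>
        (measurable_pairCount u v).mul_const _,
      ENNReal.ofReal_sum_of_nonneg fun u _ => Finset.sum_nonneg fun v _ => hnn u v,
      Finset.mul_sum]
    refine Finset.sum_congr rfl fun u _ => ?_
    rw [lintegral_finsetSum _ fun v _ => (measurable_pairCount u v).mul_const _,
      ENNReal.ofReal_sum_of_nonneg fun v _ => hnn u v, Finset.mul_sum]
    refine Finset.sum_congr rfl fun v _ => ?_
    rw [lintegral_mul_const _ (measurable_pairCount u v),
      lintegral_stationaryMeasure_pairCount hindep hident hnondeg ha, ← hF,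
      ENNReal.ofReal_mul (hFnn _), ENNReal.ofReal_mul (trans_nonneg _ _ _ _ _), mul_assoc]
  simp only [h2]
  rw [lintegral_const_mul' _ _ (by simp), ← ofReal_integral_eq_lintegral_ofReal,
    integral_sum_sum_trans hindep hident ha F s 0 x y subset_rfl subset_rfl,
    iterate_diffStep_invariantCov hα hβ, invariantCov_of_ne hα (sub_ne_zero.2 hxy.symm),
    ENNReal.ofReal_one, mul_one]
  · exact integrable_finsetSum _ fun u _ => integrable_finsetSum _ fun v _ =>
      (integrable_trans_mul P s 0 x y u v).const_mul _
  · exact Eventually.of_forall fun ω => Finset.sum_nonneg fun u _ => Finset.sum_nonneg fun v _ =>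
      mul_nonneg (hFnn _) (mul_nonneg (trans_nonneg _ _ _ _ _) (trans_nonneg _ _ _ _ _))

end Occupation

end DynEnv

end

/-! ### Uncorrelated occupation variables -/

theorem mainTheorem3 (R : ℕ) (P : Measure (DynEnv.Env R)) [IsProbabilityMeasure P]
    -- the jump laws at the space-time points are i.i.d.
    (hindep : iIndepFun (fun (i : ℤ × ℤ) (ω : DynEnv.Env R) => ω i) P)
    (hident : ∀ i : ℤ × ℤ, IdentDistrib (fun ω : DynEnv.Env R => ω i) (fun ω => ω (0, 0)) P P)
    -- nondegeneracy of the quenched walk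
    (hnondeg : 0 < P {ω | ∃ z : ℤ, 0 < (ω (0, 0)).1 z ∧ (ω (0, 0)).1 z < 1})
    -- aperiodicity of the averaged walk
    (haper : ¬ ∃ (x : ℤ) (G : AddSubgroup ℤ), G ≠ ⊤ ∧
      ∑' z : G, DynEnv.meanKernel P (x + (z : ℤ)) = 1)
    -- the mean kernel lives on two adjacent sites
    (htwo : ∃ x : ℤ, DynEnv.meanKernel P x + DynEnv.meanKernel P (x + 1) = 1) :
    -- the density is well defined and square integrable
    (∀ᵐ ω ∂P, Tendsto (fun N : ℕ => DynEnv.preDensity N ω) atTop (𝓝 (DynEnv.density ω))) ∧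
    MemLp DynEnv.density 2 P ∧
    ∫ ω, DynEnv.density ω ∂P = 1 ∧
    -- its spatial translates are uncorrelated
    (∀ m : ℤ, m ≠ 0 →
      covariance DynEnv.density (fun ω => DynEnv.density (DynEnv.shift 0 m ω)) P = 0) ∧
    -- occupation variables are uncorrelated under the stationary measure
    (∀ (ρ : ℝ≥0),
      (∀ x : ℤ, MemLp (fun η : DynEnv.Config => (η x : ℝ)) 2 (DynEnv.stationaryMeasure P ρ)) ∧
      ∀ x y : ℤ, x ≠ y → covariance (fun η : DynEnv.Config => (η x : ℝ)) (fun η => (η y : ℝ))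
        (DynEnv.stationaryMeasure P ρ) = 0) ∧
    -- and so they are at every fixed time of the process started from that measure
    (∀ (ρ : ℝ≥0) (s : ℕ),
      (∀ x : ℤ, MemLp (fun c => (DynEnv.occupation s x c : ℝ)) 2
        (DynEnv.particleLaw P (DynEnv.stationaryMeasure P ρ))) ∧
      ∀ x y : ℤ, x ≠ y → covariance (fun c => (DynEnv.occupation s x c : ℝ))
        (fun c => (DynEnv.occupation s y c : ℝ))
        (DynEnv.particleLaw P (DynEnv.stationaryMeasure P ρ)) = 0) := by
  obtain ⟨a, ha⟩ := htwo
  have hpos := (DynEnv.crossMoment_pos ha hnondeg).trans_le (DynEnv.crossMoment_le ha)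
  have hzero : ∀ ω : DynEnv.Env R, DynEnv.shift 0 0 ω = ω := fun ω => by
    funext i
    simp [DynEnv.shift]
  obtain ⟨hlim, hmem, -⟩ := DynEnv.tendsto_preDensity_shift hindep hident hnondeg ha 0
  have hmean := DynEnv.integral_density_shift hindep hident hnondeg ha
  have hmean0 := hmean 0
  simp only [hzero] at hlim hmem hmean0
  refine ⟨hlim, hmem, hmean0, fun m hm => ?_, fun ρ => ⟨fun x => ?_, fun x y hxy => ?_⟩,
    fun ρ s => ⟨fun x => ?_, fun x y hxy => ?_⟩⟩
  · have h := DynEnv.integral_density_mul hindep hident hnondeg ha 0 m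
    simp only [hzero, sub_zero] at h
    rw [covariance_eq_sub hmem (DynEnv.tendsto_preDensity_shift hindep hident hnondeg ha m).2.1,
      hmean0, hmean m]
    simp only [Pi.mul_apply]
    rw [h, DynEnv.invariantCov_of_ne hpos hm]
    ring
  · exact DynEnv.memLp_stationaryMeasure_apply hindep hident hnondeg ha ρ x
  · exact DynEnv.covariance_stationaryMeasure hindep hident hnondeg ha ρ hxy
  · exact DynEnv.memLp_occupation hindep hident hnondeg ha ρ s x
  · exact DynEnv.covariance_natCast_eq_zero (m := ρ)
      (DynEnv.memLp_occupation hindep hident hnondeg ha ρ s x)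
      (DynEnv.memLp_occupation hindep hident hnondeg ha ρ s y)
      (DynEnv.lintegral_occupation hindep hident hnondeg ha ρ s x)
      (DynEnv.lintegral_occupation hindep hident hnondeg ha ρ s y)
      (DynEnv.lintegral_occupation_mul hindep hident hnondeg ha ρ s hxy)
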